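/- Let $\mathbb{K}$ be a field of characteristic zero, $n,p\ge 0$, and $f_1,\dots,f_p\in R=\mathbb{K}[x_1,\dots,x_n]$. Let $D_n=\mathbb{K}\langle x_i,\partial_i\mid \partial_i x_k=x_k\partial_i+\delta_{ik}\rangle$ be the $n$-th Weyl algebra, and put $D_n[s]=D_n\otimes_{\mathbb K}\mathbb{K}[s_1,\dots,s_p]$. Let $E'$ be the $\mathbb{K}$-algebra generated by $x_i,\partial_i$ $(1\le i\le n)$ and $t_j,\partial t_j,s_j$ $(1\le j\le p)$, subject to $$[\partial_i,x_k]=\delta_{ik},\qquad [\partial t_j,t_k]=\delta_{jk},\qquad [t_k,s_j]=\delta_{jk}t_j,\qquad [\partial t_k,s_j]=-\delta_{jk}\,\partial t_j,$$ all other pairs of generators commuting. The standard monomials $x^a s^e t^b\partial^c\partial t^d$ form a $\mathbb{K}$-basis of $E'$. For a monomial well-ordering on the exponents $(a,e,b,c,d)$, the leading monomial $\mathrm{lm}(P)$ of $0\ne P\in E'$ is the largest standard monomial occurring in $P$. A finite set $G\subset E'$ is a left Gröbner basis if for every nonzero $P$ in the left ideal generated by $G$ there is a nonzero $g\in G$ such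 that $\mathrm{lm}(g)$ divides $\mathrm{lm}(P)$ (componentwise comparison of exponents). For two variables, $a\gg b$ means that $a$ is greater than every power of $b$. (1) Consider any monomial well-ordering on $E'$ with $t_j\gg x_i$, $\partial_i\gg x_k$, $\partial_i\gg\partial t_j$, $s_j\gg x_i$ and $s_j\gg\partial t_k$ for all indices. Then $$S_1=\{t_j-f_j\mid 1\le j\le p\}\cup\Big\{\partial_i+\sum_{k=1}^p\frac{\partial f_k}{\partial x_i}\,\partial t_k\ \Big|\ 1\le i\le n\Big\}\quad\text{and}\quad S_2=S_1\cup\{s_j+f_j\,\partial t_j\mid 1\le j\le p\}$$ are left Gröbner bases in $E'$. (2) (Briançon–Maisonobe) Suppose that all $f_j$ are nonzero. Let $D_n[s]$ act on the free rank-one $R\big[s,\tfrac1{f_1\cdots f_p}\big]$-module generated by the symbol $f^s=f_1^{s_1}\cdots f_p^{s_p}$, where $x_i$ and $s_j$ act by multiplication and $$\partial_i\bullet(b f^s)=\Big(\frac{\partial b}{\partial x_i}+b\sum_{j=1}^p s_j\,\frac{\partial f_j}{\partial x_i}\,f_j^{-1}\Big)f^s,$$ and let $\mathrm{Ann}_{D_n[s]}(f^s)$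 be the left ideal of all $P\in D_n[s]$ with $P\bullet f^s=0$. Let $S_p=\mathbb{K}\langle \partial t_j,s_j\mid \partial t_j s_k=s_k\partial t_j-\delta_{jk}\partial t_j\rangle$ be the $p$-th shift algebra (the $s_j$ commute with each other, and so do the $\partial t_j$). Then $$\mathrm{Ann}_{D_n[s]}(f^s)=I\cap D_n[s],$$ where $I$ is the left ideal of $D_n\otimes_{\mathbb{K}}S_p$ generated by the elements $s_j+f_j\,\partial t_j$ $(1\le j\le p)$ and $\partial_i+\sum_{k=1}^p\frac{\partial f_k}{\partial x_i}\,\partial t_k$ $(1\le i\le n)$. -/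

import Mathlib

namespace DModule

open MvPolynomial

theorem pderiv_pderiv_comm {K : Type*} [Field K] {σ : Type*} (v w : σ) (F : MvPolynomial σ K) :
    pderiv v (pderiv w F) = pderiv w (pderiv v F) := by
  have : ⁅(pderiv v : Derivation K (MvPolynomial σ K) (MvPolynomial σ K)),
      pderiv (R := K) w⁆ = 0 := by
    classical
    apply MvPolynomial.derivation_ext
    intro i
    simp [Derivation.commutator_apply, pderiv_X, Pi.single_apply, apply_ite]
  have := DFunLike.congr_fun this F
  simpa [Derivation.commutator_apply, sub_eq_zero] using this

/-- The defining relations `a b = b a + d(a, b)` for the generators `a`, `b`. -/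
inductive LieRel (K : Type*) [Field K] {V : Type*} (d : V → V → FreeAlgebra K V) :
    FreeAlgebra K V → FreeAlgebra K V → Prop
  | comm (a b : V) : LieRel K d (FreeAlgebra.ι K a * FreeAlgebra.ι K b)
      (FreeAlgebra.ι K b * FreeAlgebra.ι K a + d a b)

/-- The algebra `K⟨V | a b - b a = d(a, b)⟩`: the quotient of the free associative algebra on `V` by
the two-sided ideal generated by the `a b - b a - d(a, b)`. -/
abbrev LieTypeAlgebra (K : Type*) [Field K] {V : Type*} (d : V → V → FreeAlgebra K V) : Type _ :=
  RingQuot (LieRel K d)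

namespace LieTypeAlgebra

variable {K : Type*} [Field K] {V : Type*} (d : V → V → FreeAlgebra K V)

/-- The class of the generator `v`. -/
noncomputable def gen (v : V) : LieTypeAlgebra K d :=
  RingQuot.mkAlgHom K (LieRel K d) (FreeAlgebra.ι K v)

theorem gen_mul_gen (a b : V) :
    gen d a * gen d b = gen d b * gen d a + RingQuot.mkAlgHom K (LieRel K d) (d a b) := by
  have := RingQuot.mkAlgHom_rel K (LieRel.comm (K := K) (d := d) a b)
  simpa [gen] using this

/-- The algebra homomorphism with `v ↦ u v`, if the `u v` satisfy the defining relations. -/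
noncomputable def lift {A : Type*} [Ring A] [Algebra K A] (u : V → A)
    (h : ∀ a b, u a * u b = u b * u a + FreeAlgebra.lift K u (d a b)) :
    LieTypeAlgebra K d →ₐ[K] A :=
  RingQuot.liftAlgHom K ⟨FreeAlgebra.lift K u, by
    rintro _ _ ⟨a, b⟩
    simpa using h a b⟩

theorem lift_gen {A : Type*} [Ring A] [Algebra K A] (u : V → A)
    (h : ∀ a b, u a * u b = u b * u a + FreeAlgebra.lift K u (d a b)) (v : V) :
    lift d u h (gen d v) = u v := by
  simp [lift, gen]

/-- The span of all words of length at most `k` in the generators. -/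
def words (k : ℕ) : Submodule K (LieTypeAlgebra K d) :=
  Submodule.span K {P | ∃ l : List V, l.length ≤ k ∧ P = (l.map (gen d)).prod}

theorem words_mono {k m : ℕ} (h : k ≤ m) : words d k ≤ words d m :=
  Submodule.span_mono fun _ ⟨l, hl, e⟩ => ⟨l, hl.trans h, e⟩

theorem mul_mem_words {k m : ℕ} {P Q : LieTypeAlgebra K d} (hP : P ∈ words d k)
    (hQ : Q ∈ words d m) : P * Q ∈ words d (k + m) := by
  have h := Submodule.mul_mem_mul hP hQ
  rw [words, words, Submodule.span_mul_span] at h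
  refine Submodule.span_mono ?_ h
  rintro _ ⟨_, ⟨l, hl, rfl⟩, _, ⟨r, hr, rfl⟩, rfl⟩
  exact ⟨l ++ r, by simp; omega, by simp⟩

theorem prod_mem_words (l : List V) {k : ℕ} (h : l.length ≤ k) :
    (l.map (gen d)).prod ∈ words d k :=
  Submodule.subset_span ⟨l, h, rfl⟩

theorem gen_mem_words (v : V) : gen d v ∈ words d 1 := by
  simpa using prod_mem_words d [v] (k := 1) (by simp)

theorem exists_mem_words (P : LieTypeAlgebra K d) : ∃ k, P ∈ words d k := by
  obtain ⟨F, rfl⟩ := RingQuot.mkAlgHom_surjective K (LieRel K d) P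
  induction F using FreeAlgebra.induction with
  | grade0 r =>
    refine ⟨0, ?_⟩
    rw [AlgHom.commutes, Algebra.algebraMap_eq_smul_one]
    exact Submodule.smul_mem _ _ (by simpa using prod_mem_words d [] (k := 0) (by simp))
  | grade1 v => exact ⟨1, gen_mem_words d v⟩
  | mul a b ha hb =>
    obtain ⟨k, hk⟩ := ha
    obtain ⟨m, hm⟩ := hb
    exact ⟨k + m, by simpa using mul_mem_words d hk hm⟩
  | add a b ha hb =>
    obtain ⟨k, hk⟩ := ha
    obtain ⟨m, hm⟩ := hb
    refine ⟨max k m, ?_⟩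
    rw [map_add]
    exact Submodule.add_mem _ (words_mono d (le_max_left _ _) hk)
      (words_mono d (le_max_right _ _) hm)

theorem prod_sub_prod_mem (hd : ∀ a b, RingQuot.mkAlgHom K (LieRel K d) (d a b) ∈ words d 1)
    {l r : List V} (h : l.Perm r) :
    ∀ k, l.length ≤ k + 1 → (l.map (gen d)).prod - (r.map (gen d)).prod ∈ words d k := by
  induction h with
  | nil => intro k _; simp
  | cons x h ih =>
    rename_i l r
    intro k hk
    rcases k with _ | k
    · have hl : l = [] := by simpa using hk
      subst hl
      rw [h.nil_eq]
      simp
    · have := mul_mem_words d (gen_mem_words d x) (ih k (by simpa using hk))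
      rw [add_comm 1 k] at this
      simpa [mul_sub] using this
  | swap x y l =>
    intro k hk
    have := mul_mem_words d (hd y x) (prod_mem_words d l le_rfl)
    simp only [List.length_cons] at hk
    have t := words_mono d (show 1 + l.length ≤ k by omega) this
    have e := gen_mul_gen d y x
    simp only [List.map_cons, List.prod_cons, ← mul_assoc, e, add_mul, add_sub_cancel_left]
    exact t
  | trans h1 h2 ih1 ih2 =>
    intro k hk
    have := Submodule.add_mem _ (ih1 k hk) (ih2 k (by rw [← h1.length_eq]; exact hk))
    simpa using this

/-- The ordered monomial `∏ v ^ α(v)`, the factors being multiplied in the order of the list `e`. -/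
noncomputable def stdMonomial (e : List V) (α : V →₀ ℕ) : LieTypeAlgebra K d :=
  (e.map fun v => gen d v ^ α v).prod

theorem stdMonomial_eq (e : List V) (α : V →₀ ℕ) :
    stdMonomial d e α = ((e.flatMap fun v => List.replicate (α v) v).map (gen d)).prod := by
  simp only [stdMonomial]
  induction e with
  | nil => simp
  | cons a e ih => simp [ih]

theorem span_stdMonomial (hd : ∀ a b, RingQuot.mkAlgHom K (LieRel K d) (d a b) ∈ words d 1)
    (e : List V) (he : e.Nodup) (he' : ∀ v, v ∈ e) :
    ⊤ ≤ Submodule.span K (Set.range (stdMonomial d e)) := by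
  classical
  have key : ∀ k, words d k ≤ Submodule.span K (Set.range (stdMonomial d e)) := by
    intro k
    induction k with
    | zero =>
      refine Submodule.span_le.2 ?_
      rintro _ ⟨l, hl, rfl⟩
      have hl : l = [] := by simpa using hl
      subst hl
      exact Submodule.subset_span ⟨0, by simp [stdMonomial]⟩
    | succ k ih =>
      refine Submodule.span_le.2 ?_
      rintro _ ⟨l, hl, rfl⟩
      let α : V →₀ ℕ := Multiset.toFinsupp (l : Multiset V)
      have hp : l.Perm (e.flatMap fun v => List.replicate (α v) v) := by
        rw [List.perm_iff_count]
        intro v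
        rw [List.count_flatMap]
        have : (List.count v ∘ fun v => List.replicate (α v) v)
            = fun w => if w = v then α v else 0 := by
          funext w
          by_cases h : w = v
          · subst h; simp
          · simp [List.count_replicate, h]
        have h2 : ∀ e : List V, (e.map fun w => if w = v then α v else 0).sum
            = e.count v * α v := by
          intro e
          induction e with
          | nil => simp
          | cons a e ih =>
            by_cases h : a = v
            · simp [h, ih, add_mul, add_comm]
            · simp [h, ih]
        rw [this, h2, List.count_eq_one_of_mem he (he' v)]
        simp [α]
      have h1 := ih (prod_sub_prod_mem d hd hp k hl)
      rw [← stdMonomial_eq] at h1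
      have h2 := Submodule.add_mem _ h1 (Submodule.subset_span ⟨α, rfl⟩)
      simpa using h2
  intro P _
  obtain ⟨k, hk⟩ := exists_mem_words d P
  exact key k hk

end LieTypeAlgebra

/-- The generators `x_i, s_j, t_j, ∂_i, ∂t_j` of the algebra `E'`. -/
inductive VarE (n p : ℕ) : Type
  | x (i : Fin n) : VarE n p
  | s (j : Fin p) : VarE n p
  | t (j : Fin p) : VarE n p
  | d (i : Fin n) : VarE n p
  | dt (j : Fin p) : VarE n p
  deriving DecidableEq

open FreeAlgebra (ι)

/-- The commutators `[a, b]` of the generators of `E'`: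
`[∂_i, x_i] = 1`, `[∂t_j, t_j] = 1`, `[t_j, s_j] = t_j`, `[∂t_j, s_j] = -∂t_j`
(and the opposite ones); all other pairs of generators commute. -/
noncomputable def bracketE (K : Type*) [Field K] (n p : ℕ) :
    VarE n p → VarE n p → FreeAlgebra K (VarE n p)
  | .d i, .x k => if i = k then 1 else 0
  | .x k, .d i => if i = k then -1 else 0
  | .dt j, .t k => if j = k then 1 else 0
  | .t k, .dt j => if j = k then -1 else 0
  | .t k, .s j => if j = k then ι K (.t k) else 0
  | .s j, .t k => if j = k then -ι K (.t k) else 0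
  | .dt k, .s j => if j = k then -ι K (.dt k) else 0
  | .s j, .dt k => if j = k then ι K (.dt k) else 0
  | _, _ => 0

/-- The algebra `E' = K⟨x_i, ∂_i, t_j, ∂t_j, s_j⟩`, that is the tensor product of the `n`-th Weyl
algebra with the algebra generated by `K[s]` and the `p`-th Weyl algebra in `t, ∂t` subject to
`[t_k, s_j] = δ_{jk} t_k` and `[∂t_k, s_j] = -δ_{jk} ∂t_k`. -/
abbrev AlgE (K : Type*) [Field K] (n p : ℕ) : Type _ := LieTypeAlgebra K (bracketE K n p)

/-- The order `x, s, t, ∂, ∂t` of the factors in a standard monomial of `E'`. -/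
def enumE (n p : ℕ) : List (VarE n p) :=
  List.ofFn VarE.x ++ List.ofFn VarE.s ++ List.ofFn VarE.t ++ List.ofFn VarE.d ++ List.ofFn VarE.dt

theorem enumE_nodup (n p : ℕ) : (enumE n p).Nodup := by
  simp only [enumE, List.nodup_append, List.nodup_ofFn, List.mem_append, List.mem_ofFn]
  refine ⟨⟨⟨⟨?_, ?_, ?_⟩, ?_, ?_⟩, ?_, ?_⟩, ?_, ?_⟩ <;>
    first
    | (intro a b h; injection h)
    | grind

theorem mem_enumE {n p : ℕ} (v : VarE n p) : v ∈ enumE n p := by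
  cases v <;> simp [enumE, List.mem_ofFn]

section Rep
variable (K : Type*) [Field K] {n p : ℕ}

/-- The substitution `s_j ↦ s_j + c`. -/
noncomputable def shiftE (j : Fin p) (c : K) :
    MvPolynomial (VarE n p) K →ₐ[K] MvPolynomial (VarE n p) K :=
  aeval fun v => if v = .s j then X v + C c else X v

/-- Left multiplication by a generator of `E'`, written in normally ordered coordinates. -/
noncomputable def actE : VarE n p → Module.End K (MvPolynomial (VarE n p) K)
  | .x i => LinearMap.mulLeft K (X (.x i))
  | .s j => LinearMap.mulLeft K (X (.s j))
  | .t j => LinearMap.mulLeft K (X (.t j)) ∘ₗ (shiftE K j 1).toLinearMap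
  | .d i => LinearMap.mulLeft K (X (.d i)) + (pderiv (.x i)).toLinearMap
  | .dt j => (LinearMap.mulLeft K (X (.dt j)) + (pderiv (.t j)).toLinearMap) ∘ₗ
      (shiftE K j (-1)).toLinearMap

theorem pderiv_shiftE (v : VarE n p) (hv : ∀ j, v ≠ .s j) (j : Fin p) (c : K)
    (F : MvPolynomial (VarE n p) K) :
    pderiv v (shiftE K j c F) = shiftE K j c (pderiv v F) := by
  induction F using MvPolynomial.induction_on with
  | C a => simp [shiftE]
  | add a b ha hb => simp [ha, hb]
  | mul_X a w ha =>
    have : pderiv v (shiftE K j c (X w)) = shiftE K j c (pderiv v (X w)) := by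
      simp only [shiftE, aeval_X]
      split_ifs <;> by_cases h : w = v <;> simp_all [pderiv_X]
    simp only [map_mul, pderiv_mul, map_add, ha, this]

theorem shiftE_comm (j k : Fin p) (b c : K) (F : MvPolynomial (VarE n p) K) :
    shiftE K j b (shiftE K k c F) = shiftE K k c (shiftE K j b F) := by
  have : (shiftE (n := n) K j b).comp (shiftE K k c) = (shiftE K k c).comp (shiftE K j b) := by
    ext1 v
    simp only [shiftE, AlgHom.comp_apply, aeval_X]
    split_ifs <;> simp_all [add_right_comm]
  exact congrArg (fun g => g F) this

theorem shiftE_cancel (j : Fin p) (c : K) (F : MvPolynomial (VarE n p) K) :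
    shiftE K j c (shiftE K j (-c) F) = F := by
  have : (shiftE (n := n) K j c).comp (shiftE K j (-c)) = AlgHom.id K _ := by
    ext1 v
    simp only [shiftE, AlgHom.comp_apply, aeval_X]
    split_ifs <;> simp_all
  exact congrArg (fun g => g F) this

theorem actE_rel (a b : VarE n p) : actE K a * actE K b
    = actE K b * actE K a + FreeAlgebra.lift K (actE K) (bracketE K n p a b) := by
  have hX : ∀ j (c : K) (v : VarE n p), shiftE K j c (X v) = if v = .s j then X v + C c else X v :=
    fun j c v => by simp [shiftE]
  have hp1 := fun i => pderiv_shiftE K (n := n) (p := p) (.x i) (by simp)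
  have hp2 := fun i => pderiv_shiftE K (n := n) (p := p) (.t i) (by simp)
  cases a <;> cases b <;> refine LinearMap.ext fun F => ?_ <;>
    simp only [actE, bracketE, Module.End.mul_apply, LinearMap.add_apply, LinearMap.comp_apply,
      LinearMap.mulLeft_apply, AlgHom.toLinearMap_apply, Derivation.coeFn_coe, map_zero,
      LinearMap.zero_apply, map_mul, map_add, pderiv_mul, hX, hp1, hp2, pderiv_X, Pi.single_apply,
      reduceCtorEq, if_false]
  all_goals first
    | ring1
    | (rw [shiftE_comm]; ring1)
    | (rw [pderiv_pderiv_comm]; ring1)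
    | (split_ifs <;> subst_vars <;>
        simp_all [actE, shiftE_comm K _ _ 1 (-1), pderiv_X] <;> ring1)
    | skip
  case t.dt k j =>
    rw [shiftE_comm K j k, shiftE_comm K j k]
    rcases eq_or_ne j k with rfl | h
    · have hc := shiftE_cancel K (n := n) j 1 F
      simp only [if_true, hc, map_neg, map_one, LinearMap.neg_apply, Module.End.one_apply]
      ring1
    · simp [h, h.symm]
      ring1
  case dt.t j k =>
    rw [shiftE_comm K j k, shiftE_comm K j k]
    rcases eq_or_ne j k with rfl | h
    · have hc := shiftE_cancel K (n := n) j 1 F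
      simp only [if_true, hc, map_one, Module.End.one_apply]
      ring1
    · simp [h, h.symm]
      ring1
  case dt.dt j k =>
    simp only [shiftE_comm K k j]
    rw [pderiv_pderiv_comm]
    ring1

/-- The left regular representation of `E'` in normally ordered coordinates. -/
noncomputable def repE : AlgE K n p →ₐ[K] Module.End K (MvPolynomial (VarE n p) K) :=
  LieTypeAlgebra.lift _ (actE K) (actE_rel K)

theorem repE_gen (v : VarE n p) : repE K (LieTypeAlgebra.gen _ v) = actE K v :=
  LieTypeAlgebra.lift_gen _ _ _ v

/-- The position of the block to which a generator belongs. -/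
def rankE : VarE n p → ℕ
  | .x _ => 0
  | .s _ => 1
  | .t _ => 2
  | .d _ => 3
  | .dt _ => 4

theorem shiftE_monomial (j : Fin p) (c : K) (β : VarE n p →₀ ℕ) (hβ : β (.s j) = 0) :
    shiftE K j c (monomial β 1) = monomial β 1 := by
  rw [monomial_eq, map_mul, Finsupp.prod, map_prod]
  congr 1
  · simp [shiftE]
  · refine Finset.prod_congr rfl fun v hv => ?_
    have : v ≠ .s j := by rintro rfl; simp_all
    simp [shiftE, this]

theorem actE_monomial (v : VarE n p) (β : VarE n p →₀ ℕ)
    (hβ : ∀ u, β u ≠ 0 → rankE v ≤ rankE u) :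
    actE K v (monomial β 1) = monomial (Finsupp.single v 1 + β) 1 := by
  have h0 : ∀ u, rankE u < rankE v → β u = 0 := fun u hu => by
    by_contra h
    exact absurd (hβ u h) (by omega)
  have hX : ∀ v : VarE n p, (X v * monomial β 1 : MvPolynomial _ K)
      = monomial (Finsupp.single v 1 + β) 1 := fun v => by
    rw [X, monomial_mul, one_mul]
  cases v with
  | x i => simp [actE, hX]
  | s j => simp [actE, hX]
  | t j => simp [actE, shiftE_monomial K j 1 β (h0 _ (by simp [rankE])), hX]
  | d i => simp [actE, hX, pderiv_monomial, h0 (.x i) (by simp [rankE])]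
  | dt j =>
    simp [actE, hX, shiftE_monomial K j (-1) β (h0 _ (by simp [rankE])), pderiv_monomial,
      h0 (.t j) (by simp [rankE])]

theorem list_actE (α : VarE n p →₀ ℕ) (l : List (VarE n p))
    (hl : l.Pairwise fun v u => rankE v ≤ rankE u) :
    (l.map fun v => actE K v ^ α v).prod 1
      = monomial (l.map fun v => Finsupp.single v (α v)).sum 1 ∧
    ∀ u, (l.map fun v => Finsupp.single v (α v)).sum u ≠ 0 → u ∈ l := by
  classical
  induction l with
  | nil => simp
  | cons v l ih =>
    rw [List.pairwise_cons] at hl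
    obtain ⟨ih1, ih2⟩ := ih hl.2
    have hu : ∀ u, ((v :: l).map fun v => Finsupp.single v (α v)).sum u ≠ 0 → u ∈ v :: l := by
      intro u hu
      by_contra h
      rw [List.mem_cons, not_or] at h
      refine hu ?_
      have := not_imp_comm.1 (ih2 u) h.2
      simp [Ne.symm h.1, this]
    refine ⟨?_, hu⟩
    simp only [List.map_cons, List.prod_cons, List.sum_cons, Module.End.mul_apply, ih1]
    generalize α v = k
    induction k with
    | zero => simp
    | succ k ihk =>
      rw [pow_succ', Module.End.mul_apply, ihk, actE_monomial, ← add_assoc, ← Finsupp.single_add,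
        add_comm 1 k]
      intro u hu
      by_cases h : u = v
      · rw [h]
      · refine hl.1 u (ih2 u ?_)
        simpa [Finsupp.single_apply, Ne.symm h] using hu

theorem enumE_pairwise : (enumE n p).Pairwise fun v u => rankE v ≤ rankE u := by
  simp [enumE, List.pairwise_append, List.pairwise_ofFn, rankE, List.mem_ofFn]
  grind [rankE]

theorem sum_enumE (α : VarE n p →₀ ℕ) :
    ((enumE n p).map fun v => Finsupp.single v (α v)).sum = α := by
  classical
  have h : ∀ l : List (VarE n p), l.Nodup → ∀ u,
      (l.map fun v => Finsupp.single v (α v)).sum u = if u ∈ l then α u else 0 := by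
    intro l hl u
    induction l with
    | nil => simp
    | cons v l ih =>
      rw [List.nodup_cons] at hl
      by_cases huv : u = v
      · subst huv
        simp [ih hl.2, hl.1]
      · simp [ih hl.2, huv]
  ext u
  rw [h _ (enumE_nodup n p), if_pos (mem_enumE u)]

theorem repE_stdMonomial (α : VarE n p →₀ ℕ) :
    repE K (LieTypeAlgebra.stdMonomial _ (enumE n p) α) 1 = monomial α 1 := by
  have := (list_actE K α _ (enumE_pairwise (n := n) (p := p))).1
  rw [sum_enumE] at this
  simpa [LieTypeAlgebra.stdMonomial, map_list_prod, List.map_map, Function.comp_def, repE_gen]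
    using this

theorem linearIndependent_stdMonomialE :
    LinearIndependent K (LieTypeAlgebra.stdMonomial (bracketE K n p) (enumE n p)) := by
  refine LinearIndependent.of_comp
    ((LinearMap.applyₗ (1 : MvPolynomial (VarE n p) K)).comp (repE K).toLinearMap) ?_
  have : (⇑((LinearMap.applyₗ (1 : MvPolynomial (VarE n p) K)).comp (repE K).toLinearMap) ∘
      LieTypeAlgebra.stdMonomial (bracketE K n p) (enumE n p))
      = basisMonomials (VarE n p) K := by
    funext α
    simpa using repE_stdMonomial K α
  rw [this]
  exact (basisMonomials (VarE n p) K).linearIndependent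

theorem bracketE_mem (a b : VarE n p) :
    RingQuot.mkAlgHom K (LieRel K (bracketE K n p)) (bracketE K n p a b)
      ∈ LieTypeAlgebra.words (bracketE K n p) 1 := by
  have h1 : (1 : AlgE K n p) ∈ LieTypeAlgebra.words (bracketE K n p) 1 := by
    simpa using LieTypeAlgebra.prod_mem_words (bracketE K n p) [] (k := 1) (by simp)
  have hg := LieTypeAlgebra.gen_mem_words (bracketE K n p)
  unfold LieTypeAlgebra.gen at hg
  cases a <;> cases b <;> simp only [bracketE] <;> (try split_ifs) <;>
    simp only [map_zero, map_one, map_neg, neg_mem_iff, zero_mem, h1, hg]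

/-- The `K`-basis of `E'` given by the standard monomials `x^a s^e t^b ∂^c ∂t^d`. -/
noncomputable def basisE : Module.Basis (VarE n p →₀ ℕ) K (AlgE K n p) :=
  .mk (linearIndependent_stdMonomialE K)
    (LieTypeAlgebra.span_stdMonomial _ (bracketE_mem K) _ (enumE_nodup n p) mem_enumE)

end Rep

/-! ### Left Gröbner bases in `E'` -/

section Groebner
variable {K : Type*} [Field K] {n p : ℕ}

/-- The exponent of the leading monomial of `P ∈ E'`: the largest exponent, with respect to the
monomial well-ordering `m`, of a standard monomial that occurs in `P` (and `0` for `P = 0`). -/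
noncomputable def leadingExp (m : MonomialOrder (VarE n p)) (P : AlgE K n p) : VarE n p →₀ ℕ :=
  m.toSyn.symm (((basisE K).repr P).support.sup m.toSyn)

/-- `G` is a (finite) left Gröbner basis of the left ideal it generates: the leading monomial of
every nonzero element of this left ideal is divisible by that of a nonzero element of `G`. -/
def IsLeftGroebnerBasis (m : MonomialOrder (VarE n p)) (G : Set (AlgE K n p)) : Prop :=
  G.Finite ∧ ∀ P ∈ Ideal.span G, P ≠ 0 → ∃ g ∈ G, g ≠ 0 ∧ leadingExp m g ≤ leadingExp m P

/-- `a ≫ b`: the variable `a` is greater than any power of the variable `b`. -/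
def MuchGreater (m : MonomialOrder (VarE n p)) (a b : VarE n p) : Prop :=
  ∀ k : ℕ, m.toSyn (Finsupp.single b k) < m.toSyn (Finsupp.single a 1)

/-- The value `h(u_1, …, u_n)` of a polynomial `h` at elements `u_i` of a `K`-algebra
(used for elements that commute with each other). -/
noncomputable def polyEval {A : Type*} [Ring A] [Algebra K A] (u : Fin n → A)
    (h : MvPolynomial (Fin n) K) : A :=
  ∑ α ∈ h.support, h.coeff α • (List.ofFn fun i => u i ^ α i).prod

/-- The generators of `E'` as elements of `E'`. -/
noncomputable abbrev genE (K : Type*) [Field K] {n p : ℕ} (v : VarE n p) : AlgE K n p :=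
  LieTypeAlgebra.gen (bracketE K n p) v

/-- A polynomial in `x_1, …, x_n` as an element of `E'`. -/
noncomputable abbrev polyE (p : ℕ) (h : MvPolynomial (Fin n) K) : AlgE K n p :=
  polyEval (fun i => genE K (.x i)) h

/-- `S_1 = {t_j - f_j} ∪ {∂_i + ∑_k (∂f_k/∂x_i) ∂t_k}`. -/
noncomputable def setS₁ (f : Fin p → MvPolynomial (Fin n) K) : Set (AlgE K n p) :=
  Set.range (fun j : Fin p => genE K (.t j) - polyE p (f j)) ∪
  Set.range (fun i : Fin n => genE K (.d i) + ∑ k, polyE p (pderiv i (f k)) * genE K (.dt k))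

/-- `S_2 = S_1 ∪ {s_j + f_j ∂t_j}`. -/
noncomputable def setS₂ (f : Fin p → MvPolynomial (Fin n) K) : Set (AlgE K n p) :=
  setS₁ f ∪ Set.range (fun j : Fin p => genE K (.s j) + polyE p (f j) * genE K (.dt j))

end Groebner

/-! ### The algebra `D_n ⊗ S_p` and the left ideal of Briançon and Maisonobe -/

section BM

/-- The generators `x_i, s_j, ∂_i, ∂t_j` of `D_n ⊗ S_p`. -/
inductive VarB (n p : ℕ) : Type
  | x (i : Fin n) : VarB n p
  | s (j : Fin p) : VarB n p
  | d (i : Fin n) : VarB n p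
  | dt (j : Fin p) : VarB n p

/-- The commutators of the generators of `D_n ⊗ S_p`: `[∂_i, x_i] = 1`, `[∂t_j, s_j] = -∂t_j`
(and the opposite ones); all other pairs of generators commute. -/
noncomputable def bracketB (K : Type*) [Field K] (n p : ℕ) :
    VarB n p → VarB n p → FreeAlgebra K (VarB n p)
  | .d i, .x k => if i = k then 1 else 0
  | .x k, .d i => if i = k then -1 else 0
  | .dt k, .s j => if j = k then -ι K (.dt k) else 0
  | .s j, .dt k => if j = k then ι K (.dt k) else 0
  | _, _ => 0

/-- The algebra `D_n ⊗ S_p = K⟨x_i, ∂_i, ∂t_j, s_j⟩`, where `S_p` is the `p`-th shift algebra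
`K⟨∂t_j, s_j | ∂t_j s_k = s_k ∂t_j - δ_{jk} ∂t_j⟩`. -/
abbrev AlgB (K : Type*) [Field K] (n p : ℕ) : Type _ := LieTypeAlgebra K (bracketB K n p)

/-- The generators `x_i, s_j, ∂_i` of `D_n[s]`. -/
inductive VarA (n p : ℕ) : Type
  | x (i : Fin n) : VarA n p
  | s (j : Fin p) : VarA n p
  | d (i : Fin n) : VarA n p

/-- The commutators of the generators of `D_n[s]`: `[∂_i, x_i] = 1` (and the opposite one); all
other pairs of generators commute. -/
noncomputable def bracketA (K : Type*) [Field K] (n p : ℕ) :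
    VarA n p → VarA n p → FreeAlgebra K (VarA n p)
  | .d i, .x k => if i = k then 1 else 0
  | .x k, .d i => if i = k then -1 else 0
  | _, _ => 0

/-- The algebra `D_n[s] = D_n ⊗ K[s_1, …, s_p]`, with `D_n` the `n`-th Weyl algebra. -/
abbrev AlgA (K : Type*) [Field K] (n p : ℕ) : Type _ := LieTypeAlgebra K (bracketA K n p)

/-- The generators of `D_n[s]` as generators of `D_n ⊗ S_p`. -/
def VarA.toB {n p : ℕ} : VarA n p → VarB n p
  | .x i => .x i
  | .s j => .s j
  | .d i => .d i

variable (K : Type*) [Field K] {n p : ℕ}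

/-- The generators of `D_n ⊗ S_p` as elements of it. -/
noncomputable abbrev genB (v : VarB n p) : AlgB K n p := LieTypeAlgebra.gen (bracketB K n p) v

/-- The inclusion `D_n[s] → D_n ⊗ S_p`. -/
noncomputable def inclAB (n p : ℕ) : AlgA K n p →ₐ[K] AlgB K n p :=
  LieTypeAlgebra.lift _ (fun v => genB K v.toB) fun a b => by
    have h := LieTypeAlgebra.gen_mul_gen (bracketB K n p) a.toB b.toB
    cases a <;> cases b <;> simp only [VarA.toB, bracketA, bracketB] at h ⊢ <;> rw [h] <;>
      congr 1 <;> (try split_ifs) <;> simp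

variable {K}

/-- The left ideal `⟨s_j + f_j ∂t_j, ∂_i + ∑_k (∂f_k/∂x_i) ∂t_k⟩` of `D_n ⊗ S_p`. -/
noncomputable def bmIdeal (f : Fin p → MvPolynomial (Fin n) K) : Ideal (AlgB K n p) :=
  Ideal.span
    (Set.range (fun j : Fin p =>
      genB K (.s j) + polyEval (fun i => genB K (.x i)) (f j) * genB K (.dt j)) ∪
    Set.range (fun i : Fin n => genB K (.d i) +
      ∑ k, polyEval (fun l => genB K (.x l)) (pderiv i (f k)) * genB K (.dt k)))

end BM

/-! ### The `D_n[s]`-module generated by `f^s` -/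

section Loc
variable {K : Type*} [Field K] {P : Type*} [CommRing P] [Algebra K P] (S : Submonoid P)
  (L : Type*) [CommRing L] [Algebra K L] [Algebra P L] [IsScalarTower K P L] [IsLocalization S L]

/-- The homomorphism `a ↦ a + ε D(a)` from `P` to `L[ε]`. -/
noncomputable def dualHom (D : Derivation K P P) : P →ₐ[K] TrivSqZeroExt L L where
  toFun a := TrivSqZeroExt.inl (algebraMap P L a) + TrivSqZeroExt.inr (algebraMap P L (D a))
  map_one' := by simp
  map_zero' := by simp
  map_add' a b := by
    ext <;> simp only [TrivSqZeroExt.fst_add, TrivSqZeroExt.snd_add, TrivSqZeroExt.fst_inl,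
      TrivSqZeroExt.snd_inl, TrivSqZeroExt.fst_inr, TrivSqZeroExt.snd_inr, map_add] <;> ring
  map_mul' a b := by
    ext <;> simp only [TrivSqZeroExt.fst_add, TrivSqZeroExt.snd_add, TrivSqZeroExt.fst_inl,
      TrivSqZeroExt.snd_inl, TrivSqZeroExt.fst_inr, TrivSqZeroExt.snd_inr, map_add, map_mul,
      TrivSqZeroExt.fst_mul, TrivSqZeroExt.snd_mul, Derivation.leibniz, smul_eq_mul,
      MulOpposite.smul_eq_mul_unop, MulOpposite.unop_op] <;> ring
  commutes' r := by
    ext <;> simp [TrivSqZeroExt.algebraMap_eq_inl', ← IsScalarTower.algebraMap_apply]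

/-- The extension of `dualHom` to the localization `L`. -/
noncomputable def locDualHom (D : Derivation K P P) : L →ₐ[K] TrivSqZeroExt L L :=
  IsLocalization.liftAlgHom (M := S) (f := dualHom L D) fun y => by
    rw [TrivSqZeroExt.isUnit_iff_isUnit_fst]
    simpa [dualHom] using IsLocalization.map_units L y

theorem locDualHom_algebraMap (D : Derivation K P P) (a : P) :
    locDualHom S L D (algebraMap P L a) = TrivSqZeroExt.inl (algebraMap P L a) +
      TrivSqZeroExt.inr (algebraMap P L (D a)) := by
  simp [locDualHom, dualHom]

theorem fst_locDualHom (D : Derivation K P P) (a : L) : (locDualHom S L D a).fst = a := by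
  have : (TrivSqZeroExt.fstHom K L L).comp (locDualHom S L D) = AlgHom.id K L := by
    apply AlgHom.coe_ringHom_injective
    apply IsLocalization.ringHom_ext S
    ext a
    simp [locDualHom_algebraMap]
  exact DFunLike.congr_fun this a

/-- The unique extension of a derivation `D` of `P` to the localization `L = S⁻¹P`. -/
noncomputable def locDeriv (D : Derivation K P P) : Derivation K L L :=
  Derivation.mk' ((TrivSqZeroExt.sndHom L L).restrictScalars K ∘ₗ (locDualHom S L D).toLinearMap)
    fun a b => by simp [fst_locDualHom, mul_comm]

@[simp] theorem locDeriv_algebraMap (D : Derivation K P P) (a : P) :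
    locDeriv S L D (algebraMap P L a) = algebraMap P L (D a) := by
  simp [locDeriv, locDualHom_algebraMap]
  rw [Algebra.smul_def, mul_one]

theorem locDeriv_comm (D E : Derivation K P P) (h : ∀ a, D (E a) = E (D a)) (b : L) :
    locDeriv S L D (locDeriv S L E b) = locDeriv S L E (locDeriv S L D b) := by
  obtain ⟨a, y, rfl⟩ := IsLocalization.exists_mk'_eq S b
  set u := IsLocalization.mk' L a y with hu
  have hy : u * algebraMap P L (y : P) = algebraMap P L a := IsLocalization.mk'_spec L a y
  let B : Derivation K L L := ⁅locDeriv S L D, locDeriv S L E⁆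
  have h1 := congrArg (fun b => B b) hy
  have h2 : ∀ c : P, B (algebraMap P L c) = 0 := fun c => by
    simp [B, Derivation.commutator_apply, h]
  beta_reduce at h1
  rw [Derivation.leibniz, h2, h2, smul_zero, zero_add, smul_eq_mul] at h1
  have h3 := (IsLocalization.map_units L y).mul_right_eq_zero.1 h1
  rwa [Derivation.commutator_apply, sub_eq_zero] at h3

end Loc

section Annihilator
variable {K : Type*} [Field K] {n p : ℕ}

/-- The polynomial ring `K[x, s]`. -/
abbrev PolyXS (K : Type*) [Field K] (n p : ℕ) : Type _ := MvPolynomial (Fin n ⊕ Fin p) K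

/-- The product `f_1 ⋯ f_p` in `K[x, s]`. -/
noncomputable def prodXS (f : Fin p → MvPolynomial (Fin n) K) : PolyXS K n p :=
  ∏ j, rename Sum.inl (f j)

/-- The free `K[x, s, 1/(f_1 ⋯ f_p)]`-module of rank one on the symbol `f^s`; its element `b f^s` is
represented by the coefficient `b`. -/
abbrev ModFs (f : Fin p → MvPolynomial (Fin n) K) : Type _ := Localization.Away (prodXS f)

section Connection
variable (S : Submonoid (PolyXS K n p)) (L : Type*) [CommRing L] [Algebra K L]
  [Algebra (PolyXS K n p) L] [IsScalarTower K (PolyXS K n p) L] [IsLocalization S L]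

/-- The logarithmic derivative `∂_i(f^s) / f^s = ∑_j s_j (∂f_j/∂x_i) / f_j`. -/
noncomputable def logDerivFs (f : Fin p → MvPolynomial (Fin n) K) (i : Fin n) : L :=
  ∑ j, algebraMap (PolyXS K n p) L (X (Sum.inr j) * rename Sum.inl (pderiv i (f j))) *
    Ring.inverse (algebraMap (PolyXS K n p) L (rename Sum.inl (f j)))

/-- The operators on the coefficients `b` of `b f^s`: `x_i` and `s_j` act by multiplication, and
`∂_i (b f^s) = (∂b/∂x_i + b ∑_j s_j (∂f_j/∂x_i) / f_j) f^s`. -/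
noncomputable def actFs (f : Fin p → MvPolynomial (Fin n) K) : VarA n p → Module.End K L
  | .x i => LinearMap.mulLeft K (algebraMap (PolyXS K n p) L (X (Sum.inl i)))
  | .s j => LinearMap.mulLeft K (algebraMap (PolyXS K n p) L (X (Sum.inr j)))
  | .d i => (locDeriv S L (pderiv (Sum.inl i))).toLinearMap +
      LinearMap.mulLeft K (logDerivFs L f i)

theorem locDeriv_logDerivFs (f : Fin p → MvPolynomial (Fin n) K)
    (hf : ∀ j, IsUnit (algebraMap (PolyXS K n p) L (rename Sum.inl (f j)))) (i k : Fin n) :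
    locDeriv S L (pderiv (Sum.inl i)) (logDerivFs L f k) =
      locDeriv S L (pderiv (Sum.inl k)) (logDerivFs L f i) := by
  have hr : ∀ (i : Fin n) (h : MvPolynomial (Fin n) K),
      pderiv (Sum.inl i) (rename Sum.inl h : PolyXS K n p) = rename Sum.inl (pderiv i h) :=
    fun i h => pderiv_rename Sum.inl_injective i h
  simp only [logDerivFs, map_sum]
  refine Finset.sum_congr rfl fun j _ => ?_
  have hinv : ∀ i : Fin n, locDeriv S L (pderiv (Sum.inl i))
      (Ring.inverse (algebraMap (PolyXS K n p) L (rename Sum.inl (f j)))) =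
      -Ring.inverse (algebraMap (PolyXS K n p) L (rename Sum.inl (f j))) ^ 2 *
        algebraMap (PolyXS K n p) L (rename Sum.inl (pderiv i (f j))) := fun i => by
    rw [Derivation.leibniz_of_mul_eq_one _ (Ring.inverse_mul_cancel _ (hf j)),
      locDeriv_algebraMap, hr, smul_eq_mul]
  simp only [Derivation.leibniz, hinv, locDeriv_algebraMap, hr, smul_eq_mul, map_mul,
    pderiv_pderiv_comm i k]
  rw [pderiv_X_of_ne (by simp), pderiv_X_of_ne (by simp)]
  simp only [map_zero]
  ring

theorem actFs_rel (f : Fin p → MvPolynomial (Fin n) K)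
    (hf : ∀ j, IsUnit (algebraMap (PolyXS K n p) L (rename Sum.inl (f j)))) (a b : VarA n p) :
    actFs S L f a * actFs S L f b = actFs S L f b * actFs S L f a +
      FreeAlgebra.lift K (actFs S L f) (bracketA K n p a b) := by
  cases a <;> cases b <;> refine LinearMap.ext fun c => ?_ <;>
    simp only [actFs, bracketA, Module.End.mul_apply, LinearMap.add_apply,
      LinearMap.mulLeft_apply, Derivation.coeFn_coe, map_zero, LinearMap.zero_apply, map_add,
      Derivation.leibniz, smul_eq_mul, locDeriv_algebraMap]
  case d.d i k =>
    rw [locDeriv_logDerivFs S L f hf i k, locDeriv_comm S L _ _ (pderiv_pderiv_comm _ _)]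
    ring1
  case d.x i k =>
    rcases eq_or_ne i k with rfl | h
    · simp
      ring1
    · rw [pderiv_X_of_ne (by simpa using h.symm)]
      simp [h]
      ring1
  case x.d k i =>
    rcases eq_or_ne i k with rfl | h
    · simp
      ring1
    · rw [pderiv_X_of_ne (by simpa using h.symm)]
      simp [h]
      ring1
  case d.s i j =>
    rw [pderiv_X_of_ne (by simp)]
    simp
    ring1
  case s.d j i =>
    rw [pderiv_X_of_ne (by simp)]
    simp
    ring1
  all_goals ring1

end Connection

theorem isUnit_algebraMap_modFs (f : Fin p → MvPolynomial (Fin n) K) (j : Fin p) :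
    IsUnit (algebraMap (PolyXS K n p) (ModFs f) (rename Sum.inl (f j))) :=
  isUnit_of_dvd_unit (map_dvd _ (Finset.dvd_prod_of_mem (fun j => rename Sum.inl (f j)) (Finset.mem_univ j)))
    (IsLocalization.Away.algebraMap_isUnit (S := ModFs f) (prodXS f))

/-- The action of `D_n[s]` on `K[x, s, 1/(f_1 ⋯ f_p)] f^s`. -/
noncomputable def repFs (f : Fin p → MvPolynomial (Fin n) K) :
    AlgA K n p →ₐ[K] Module.End K (ModFs f) :=
  LieTypeAlgebra.lift _ (actFs (Submonoid.powers (prodXS f)) (ModFs f) f)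
    (actFs_rel _ _ f (isUnit_algebraMap_modFs f))

/-- The left ideal `Ann_{D_n[s]}(f^s)` of all operators `P` with `P f^s = 0`. -/
noncomputable def annFs (f : Fin p → MvPolynomial (Fin n) K) : Ideal (AlgA K n p) where
  carrier := {P | repFs f P 1 = 0}
  zero_mem' := by simp
  add_mem' {P Q} hP hQ := by
    simp only [Set.mem_ofPred_eq] at hP hQ ⊢
    rw [map_add, LinearMap.add_apply, hP, hQ, add_zero]
  smul_mem' P Q hQ := by
    simp only [Set.mem_ofPred_eq] at hQ ⊢
    rw [smul_eq_mul, map_mul, Module.End.mul_apply, hQ, map_zero]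

end Annihilator

end DModule

namespace DModule

open MvPolynomial

namespace LieTypeAlgebra

variable {K : Type*} [Field K] {V : Type*} {d : V → V → FreeAlgebra K V}

/-! Part (1). Every element of S₁ or S₂ has the form v + tail, where v is one of the generators t_j,
∂_i, s_j and the tail involves only variables far below v. Its leading monomial is therefore v
(`adjoin_le_wordSpan`, `leadingExp_eq`). Let T be the set of these v. It remains to show that no
nonzero element P of the ideal has a leading monomial free of all v in T. No S-pairs are computed.
Instead, E' acts on polynomials as it would on E'/⟨S⟩: the vector 1 is killed by S, and the standard
monomials free of T send 1 to distinct monomials. Applied to 1, each term of P can be rewritten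
through strictly smaller terms until only monomials free of T remain. If lm(P) were free of T, then
P·1 = 0 would express lm(P)·1 by the images of smaller monomials free of T, against linear
independence (`isLeftGroebnerBasis_image`).

Part (2). The action of D_n[s] on the module of f^s extends to D_n ⊗ S_p by ∂t_j (b f^s) = -s_j
f_j⁻¹ b(s_j - 1) f^s (`actBFs_rel`). The generators of I kill f^s, so I ∩ D_n[s] lies in the
annihilator. Conversely, modulo I every operator is congruent to a commutative polynomial F in x and
∂t (`exists_sub_evalXT_mem`), and F f^s = 0 must force F = 0. The set of such F is closed under all
partial derivatives: ∂/∂x_i is the commutator with the generator ∂_i + ∑_k (∂f_k/∂x_i) ∂t_k, which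
kills f^s, and -∂/∂(∂t_j) is the commutator with an operator t_j satisfying t_j f^s = f_j f^s.
Repeated differentiation of a nonzero F would, in characteristic zero, end at a nonzero constant
killing f^s, which is impossible in a nonzero module (`eq_zero_of_pderiv_stable`,
`eq_zero_of_repBFs_evalXT`). -/

theorem induction_on {C : LieTypeAlgebra K d → Prop} (P : LieTypeAlgebra K d)
    (algebraMap : ∀ r : K, C (algebraMap K _ r)) (gen : ∀ v, C (gen d v))
    (mul : ∀ P Q, C P → C Q → C (P * Q)) (add : ∀ P Q, C P → C Q → C (P + Q)) : C P := by
  obtain ⟨F, rfl⟩ := RingQuot.mkAlgHom_surjective K (LieRel K d) P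
  induction F using FreeAlgebra.induction with
  | grade0 r => simpa using algebraMap r
  | grade1 v => exact gen v
  | mul a b ha hb => simpa using mul _ _ ha hb
  | add a b ha hb => simpa using add _ _ ha hb

end LieTypeAlgebra

theorem apply_eq_zero_of_mem_span {K A M : Type*} [Field K] [Ring A] [Algebra K A]
    [AddCommGroup M] [Module K M] (ρ : A →ₐ[K] Module.End K M) (u : M) {G : Set A}
    (h : ∀ g ∈ G, ρ g u = 0) {P : A} (hP : P ∈ Ideal.span G) : ρ P u = 0 := by
  induction hP using Submodule.span_induction with
  | mem g hg => exact h g hg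
  | zero => simp
  | add P Q _ _ hP hQ => simp [hP, hQ]
  | smul a P _ hP => simp [hP]

/-! ### Leading monomials in E' and a module-theoretic criterion for left Gröbner bases. -/

section Multiplicativity
variable {K : Type*} [Field K] {n p : ℕ} (m : MonomialOrder (VarE n p))

/-- The exponent of a word in the generators. -/
noncomputable def wordExp {V : Type*} (l : List V) : V →₀ ℕ :=
  (l.map fun v => Finsupp.single v 1).sum

@[simp] theorem wordExp_nil {V : Type*} : wordExp ([] : List V) = 0 := rfl

@[simp] theorem wordExp_cons {V : Type*} (v : V) (l : List V) :
    wordExp (v :: l) = Finsupp.single v 1 + wordExp l := by simp [wordExp]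

@[simp] theorem wordExp_append {V : Type*} (l r : List V) :
    wordExp (l ++ r) = wordExp l + wordExp r := by simp [wordExp]

theorem wordExp_perm {V : Type*} {l r : List V} (h : l.Perm r) : wordExp l = wordExp r :=
  (h.map _).sum_eq

/-- The word in the generators of `E'` given by a list. -/
noncomputable def wordE (K : Type*) [Field K] (l : List (VarE n p)) : AlgE K n p :=
  (l.map (genE K)).prod

/-- The span of all words with exponent smaller than `c`. -/
noncomputable def wordSpan (K : Type*) [Field K] (c : m.syn) : Submodule K (AlgE K n p) :=
  Submodule.span K {P | ∃ l : List (VarE n p), m.toSyn (wordExp l) < c ∧ P = wordE K l}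

variable {m}

theorem wordE_mem {l : List (VarE n p)} {c : m.syn} (h : m.toSyn (wordExp l) < c) :
    wordE K l ∈ wordSpan m K c :=
  Submodule.subset_span ⟨l, h, rfl⟩

theorem wordE_append (l r : List (VarE n p)) : wordE K (l ++ r) = wordE K l * wordE K r := by
  simp [wordE]

theorem wordE_cons (v : VarE n p) (r : List (VarE n p)) :
    wordE K (v :: r) = genE K v * wordE K r := by
  simp [wordE]

theorem wordE_mul_mem (l : List (VarE n p)) {c : m.syn} {Q : AlgE K n p}
    (hQ : Q ∈ wordSpan m K c) : wordE K l * Q ∈ wordSpan m K (m.toSyn (wordExp l) + c) := by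
  induction hQ using Submodule.span_induction with
  | mem Q h =>
    obtain ⟨r, hr, rfl⟩ := h
    rw [← wordE_append]
    exact wordE_mem (by simpa using hr)
  | zero => simp
  | add P Q _ _ hP hQ => rw [mul_add]; exact add_mem hP hQ
  | smul a P _ hP => rw [mul_smul_comm]; exact Submodule.smul_mem _ _ hP

theorem mul_wordE_mem (l : List (VarE n p)) {c : m.syn} {Q : AlgE K n p}
    (hQ : Q ∈ wordSpan m K c) : Q * wordE K l ∈ wordSpan m K (c + m.toSyn (wordExp l)) := by
  induction hQ using Submodule.span_induction with
  | mem Q h =>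
    obtain ⟨r, hr, rfl⟩ := h
    rw [← wordE_append]
    exact wordE_mem (by simpa using hr)
  | zero => simp
  | add P Q _ _ hP hQ => rw [add_mul]; exact add_mem hP hQ
  | smul a P _ hP => rw [smul_mul_assoc]; exact Submodule.smul_mem _ _ hP

theorem toSyn_single_pos (v : VarE n p) : 0 < m.toSyn (Finsupp.single v 1) := by
  rw [m.toSyn_lt_iff_ne_zero, Ne, m.toSyn_eq_zero_iff]
  simp

/-- A bracket [a, b] is 0, ±1 or ± one of a and b. Each is below the product ab in any monomial
well-ordering, since generators are larger than 1. This makes leading exponents additive. -/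
theorem bracketE_mem_wordSpan (a b : VarE n p) :
    RingQuot.mkAlgHom K (LieRel K (bracketE K n p)) (bracketE K n p a b)
      ∈ wordSpan m K (m.toSyn (Finsupp.single a 1) + m.toSyn (Finsupp.single b 1)) := by
  have ha := toSyn_single_pos (m := m) a
  have hb := toSyn_single_pos (m := m) b
  have h1 : (1 : AlgE K n p) ∈
      wordSpan m K (m.toSyn (Finsupp.single a 1) + m.toSyn (Finsupp.single b 1)) := by
    simpa [wordE] using wordE_mem (K := K) (l := []) (by simpa using add_pos ha hb)
  have h2 : genE K a ∈
      wordSpan m K (m.toSyn (Finsupp.single a 1) + m.toSyn (Finsupp.single b 1)) := by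
    simpa [wordE] using wordE_mem (K := K) (l := [a]) (by simpa using hb)
  have h3 : genE K b ∈
      wordSpan m K (m.toSyn (Finsupp.single a 1) + m.toSyn (Finsupp.single b 1)) := by
    simpa [wordE] using wordE_mem (K := K) (l := [b]) (by simpa using ha)
  unfold genE LieTypeAlgebra.gen at h2 h3
  cases a <;> cases b <;> simp only [bracketE] <;> (try split_ifs) <;>
    simp only [map_zero, map_one, map_neg, neg_mem_iff, zero_mem, h1, h2, h3]

/-- Swapping two adjacent letters changes a word by a bracket times the other letters, which has
smaller order. So the order of the factors does not affect the leading term. -/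
theorem wordE_sub_wordE_mem {l r : List (VarE n p)} (h : l.Perm r) :
    wordE K l - wordE K r ∈ wordSpan m K (m.toSyn (wordExp l)) := by
  induction h with
  | nil => simp
  | cons x h ih =>
    have := wordE_mul_mem [x] ih
    simpa [wordE_cons, mul_sub, wordE] using this
  | swap x y l =>
    have := mul_wordE_mem l (bracketE_mem_wordSpan (K := K) (m := m) y x)
    have e := LieTypeAlgebra.gen_mul_gen (bracketE K n p) y x
    simp only [wordE_cons, ← mul_assoc, e, add_mul, add_sub_cancel_left, wordExp_cons, map_add]
    simpa [add_assoc] using this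
  | trans h1 h2 ih1 ih2 =>
    rw [← wordExp_perm h1] at ih2
    simpa using add_mem ih1 ih2

/-- The word that represents the standard monomial with exponent `α`. -/
def stdWord (α : VarE n p →₀ ℕ) : List (VarE n p) :=
  (enumE n p).flatMap fun v => List.replicate (α v) v

theorem wordExp_stdWord (α : VarE n p →₀ ℕ) : wordExp (stdWord α) = α := by
  have h : ∀ l : List (VarE n p), wordExp (l.flatMap fun v => List.replicate (α v) v) =
      (l.map fun v => Finsupp.single v (α v)).sum := by
    intro l
    induction l with
    | nil => rfl
    | cons a l ih => simp [ih]; simp [wordExp]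
  rw [stdWord, h, sum_enumE]

theorem basisE_apply (α : VarE n p →₀ ℕ) :
    basisE K α = LieTypeAlgebra.stdMonomial _ (enumE n p) α := by simp [basisE]

theorem basisE_eq_wordE (α : VarE n p →₀ ℕ) : basisE K α = wordE K (stdWord α) := by
  rw [basisE_apply, LieTypeAlgebra.stdMonomial_eq, stdWord, wordE]

theorem perm_of_wordExp_eq {l r : List (VarE n p)} (h : wordExp l = wordExp r) : l.Perm r := by
  have hc : ∀ (l : List (VarE n p)) v, wordExp l v = l.count v := by
    intro l v
    induction l with
    | nil => simp
    | cons a l ih => simp [ih, List.count_cons, Finsupp.single_apply, add_comm]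
  rw [List.perm_iff_count]
  intro v
  rw [← hc, ← hc, h]

/-- Links two descriptions of the same filtration: spans of words behave well under multiplication,
spans of basis elements can be read off from coordinates. A word differs from its sorted form by
words below its own exponent, so well-founded induction applies. -/
theorem wordSpan_eq (c : m.syn) :
    wordSpan m K c = Submodule.span K (basisE K '' {α | m.toSyn α < c}) := by
  apply le_antisymm
  · induction c using WellFoundedLT.induction with
    | ind c ih =>
      refine Submodule.span_le.2 ?_
      rintro _ ⟨l, hl, rfl⟩
      have h := wordE_sub_wordE_mem (K := K) (m := m)
        (perm_of_wordExp_eq (wordExp_stdWord (wordExp l)).symm)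
      have h1 := ih _ hl h
      have h2 : basisE K (wordExp l) ∈ Submodule.span K (basisE K '' {α | m.toSyn α < c}) :=
        Submodule.subset_span ⟨_, hl, rfl⟩
      have hsub : {α : VarE n p →₀ ℕ | m.toSyn α < m.toSyn (wordExp l)} ⊆
          {α | m.toSyn α < c} := fun α hα => lt_trans hα hl
      have h3 := Submodule.span_mono (Set.image_mono hsub) h1
      rw [← basisE_eq_wordE] at h3
      simpa using add_mem h3 h2
  · refine Submodule.span_le.2 ?_
    rintro _ ⟨α, hα, rfl⟩
    rw [basisE_eq_wordE]
    exact wordE_mem (by rwa [wordExp_stdWord])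

/-- The leading monomial of a product with a generator. -/
theorem basisE_mul_sub_mem (α : VarE n p →₀ ℕ) (v : VarE n p) {g : AlgE K n p}
    (hg : g - genE K v ∈ wordSpan m K (m.toSyn (Finsupp.single v 1))) :
    basisE K α * g - basisE K (α + Finsupp.single v 1)
      ∈ wordSpan m K (m.toSyn (α + Finsupp.single v 1)) := by
  have h1 := wordE_mul_mem (stdWord α) hg
  have h2 := wordE_sub_wordE_mem (K := K) (m := m) (l := stdWord α ++ [v])
    (r := stdWord (α + Finsupp.single v 1))
    (perm_of_wordExp_eq (by simp [wordExp_stdWord]))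
  simp only [wordExp_stdWord, wordExp_append, wordExp_cons, wordExp_nil, add_zero] at h1 h2
  rw [← map_add] at h1
  have := add_mem h1 h2
  rw [wordE_append, ← basisE_eq_wordE, ← basisE_eq_wordE, wordE_cons] at this
  simpa [wordE, mul_sub] using this

theorem repr_eq_zero_of_mem_wordSpan {c : m.syn} {P : AlgE K n p} (hP : P ∈ wordSpan m K c)
    {α : VarE n p →₀ ℕ} (hα : c ≤ m.toSyn α) : (basisE K).repr P α = 0 := by
  rw [wordSpan_eq] at hP
  by_contra h
  have := (basisE K).mem_span_image.1 hP (Finsupp.mem_support_iff.2 h)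
  exact absurd this (not_lt.2 hα)

theorem leadingExp_eq {α : VarE n p →₀ ℕ} {P : AlgE K n p}
    (h : P - basisE K α ∈ wordSpan m K (m.toSyn α)) : P ≠ 0 ∧ leadingExp m P = α := by
  have h1 : ∀ β, m.toSyn α ≤ m.toSyn β → (basisE K).repr P β = Finsupp.single α 1 β := by
    intro β hβ
    have := repr_eq_zero_of_mem_wordSpan h hβ
    simpa [sub_eq_zero] using this
  have h2 : (basisE K).repr P α = 1 := by simpa using h1 α le_rfl
  refine ⟨by rintro rfl; simp at h2, ?_⟩
  rw [leadingExp, AddEquiv.symm_apply_eq]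
  apply le_antisymm
  · refine Finset.sup_le fun β hβ => ?_
    by_contra hlt
    rw [not_le] at hlt
    have := h1 β hlt.le
    rw [Finsupp.single_eq_of_ne (by rintro rfl; exact lt_irrefl _ hlt)] at this
    exact Finsupp.mem_support_iff.1 hβ this
  · exact Finset.le_sup (f := m.toSyn) (by simp [h2])

theorem repr_leadingExp_ne_zero {P : AlgE K n p} (hP : P ≠ 0) :
    (basisE K).repr P (leadingExp m P) ≠ 0 := by
  have hs : ((basisE K).repr P).support.Nonempty := by simpa using hP
  obtain ⟨α, hα, e⟩ := Finset.exists_mem_eq_sup _ hs m.toSyn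
  rw [leadingExp, e, AddEquiv.symm_apply_apply]
  exact Finsupp.mem_support_iff.1 hα

theorem sub_smul_mem_wordSpan {P : AlgE K n p} :
    P - (basisE K).repr P (leadingExp m P) • basisE K (leadingExp m P)
      ∈ wordSpan m K (m.toSyn (leadingExp m P)) := by
  rw [wordSpan_eq, (basisE K).mem_span_image]
  intro β hβ
  have hne : β ≠ leadingExp m P := by
    rintro rfl
    simp at hβ
  have hβ' : β ∈ ((basisE K).repr P).support := by
    simpa [Finsupp.single_eq_of_ne hne] using hβ
  refine lt_of_le_of_ne ?_ (m.toSyn.injective.ne hne)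
  rw [leadingExp, AddEquiv.apply_symm_apply]
  exact Finset.le_sup (f := m.toSyn) hβ'

/-- If the generators in `T` are the leading monomials of elements `g v` that annihilate a vector
`u`, and the remaining standard monomials applied to `u` are linearly independent, then the `g v`
form a left Gröbner basis. -/
theorem isLeftGroebnerBasis_image {M : Type*} [AddCommGroup M] [Module K M]
    (ρ : AlgE K n p →ₐ[K] Module.End K M) (u : M) (T : Set (VarE n p)) (hT : T.Finite)
    (g : VarE n p → AlgE K n p)
    (hg : ∀ v ∈ T, g v - genE K v ∈ wordSpan m K (m.toSyn (Finsupp.single v 1)))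
    (hρ : ∀ v ∈ T, ρ (g v) u = 0)
    (hu : LinearIndependent K fun α : {α : VarE n p →₀ ℕ // ∀ v ∈ T, α v = 0} =>
      ρ (basisE K α.1) u) :
    IsLeftGroebnerBasis m (g '' T) := by
  refine ⟨hT.image g, fun P hP hP0 => ?_⟩
  have hkill : ∀ {Q}, Q ∈ Ideal.span (g '' T) → ρ Q u = 0 := fun hQ =>
    apply_eq_zero_of_mem_span ρ u (by rintro _ ⟨v, hv, rfl⟩; exact hρ v hv) hQ
  let ev : AlgE K n p →ₗ[K] M := (LinearMap.applyₗ u).comp ρ.toLinearMap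
  let Nf : m.syn → Submodule K M := fun c =>
    Submodule.span K ((fun α : {α : VarE n p →₀ ℕ // ∀ v ∈ T, α v = 0} =>
      ρ (basisE K α.1) u) '' {α | m.toSyn α.1 < c})
  have hmono : ∀ {b c : m.syn}, b ≤ c → Nf b ≤ Nf c := fun {b c} h => by
    have hsub : {α : {α : VarE n p →₀ ℕ // ∀ v ∈ T, α v = 0} | m.toSyn α.1 < b} ⊆
        {α | m.toSyn α.1 < c} := fun α hα => lt_of_lt_of_le hα h
    exact Submodule.span_mono (Set.image_mono hsub)
  -- Normal form reduction, carried out on the images of u: whatever lies below c acts on u as a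
  -- combination of monomials free of T and below c.
  have hred : ∀ c, ∀ Q ∈ wordSpan m K c, ev Q ∈ Nf c := by
    intro c
    induction c using WellFoundedLT.induction with
    | ind c ih =>
      intro Q hQ
      rw [wordSpan_eq] at hQ
      refine Submodule.span_induction ?_ (by simp) (fun P Q _ _ hP hQ => ?_)
        (fun a P _ hP => ?_) hQ
      · rintro _ ⟨α, hα, rfl⟩
        by_cases hn : ∀ v ∈ T, α v = 0
        · exact Submodule.subset_span ⟨⟨α, hn⟩, hα, rfl⟩
        · push Not at hn
          obtain ⟨v, hv, hαv⟩ := hn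
          obtain ⟨β, rfl⟩ : ∃ β, α = β + Finsupp.single v 1 :=
            ⟨α - Finsupp.single v 1,
            (tsub_add_cancel_of_le (by simpa using Nat.one_le_iff_ne_zero.2 hαv)).symm⟩
          -- The product `basisE K β * g v` has leading monomial β + v and kills u. Hence the image
          -- of that monomial equals, up to sign, the image of an element of strictly smaller order.
          have h1 := ih _ hα _ (basisE_mul_sub_mem β v (hg v hv))
          have h2 : ev (basisE K β * g v) = 0 := by simp [ev, hρ v hv]
          rw [map_sub, h2, zero_sub, neg_mem_iff] at h1
          exact hmono (le_of_lt hα) h1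
      · rw [map_add]; exact add_mem hP hQ
      · rw [map_smul]; exact Submodule.smul_mem _ _ hP
  by_cases hn : ∀ v ∈ T, leadingExp m P v = 0
  · exfalso
    -- As P kills u, the image of its leading term is minus the image of the lower terms, hence a
    -- combination of images of smaller monomials free of T. This contradicts `hu`.
    have h1 := hred _ _ (sub_smul_mem_wordSpan (m := m) (P := P))
    have h2 : ev P = 0 := hkill hP
    rw [map_sub, h2, zero_sub, neg_mem_iff, map_smul,
      Submodule.smul_mem_iff _ (repr_leadingExp_ne_zero hP0)] at h1
    have := hu.notMem_span_image (x := ⟨leadingExp m P, hn⟩)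
      (s := {α | m.toSyn α.1 < m.toSyn (leadingExp m P)}) (by simp)
    exact this h1
  · push Not at hn
    obtain ⟨v, hv, hPv⟩ := hn
    have hb : basisE K (Finsupp.single v 1) = genE K v := by
      have := perm_of_wordExp_eq (l := stdWord (Finsupp.single v 1)) (r := [v])
        (by simp [wordExp_stdWord])
      rw [basisE_eq_wordE, List.perm_singleton.1 this]
      simp [wordE]
    obtain ⟨h1, h2⟩ := leadingExp_eq (m := m) (P := g v) (α := Finsupp.single v 1)
      (by rw [hb]; exact hg v hv)
    refine ⟨g v, ⟨v, hv, rfl⟩, h1, ?_⟩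
    rw [h2]
    simpa using Nat.one_le_iff_ne_zero.2 hPv

theorem toSyn_lt_of_muchGreater (v : VarE n p) (α : VarE n p →₀ ℕ)
    (h : ∀ u, α u ≠ 0 → MuchGreater m v u) : m.toSyn α < m.toSyn (Finsupp.single v 1) := by
  classical
  -- Multiples are needed for the induction: a sum of two exponents is at most twice the larger one,
  -- so the bound for all multiples of each summand gives it for the sum.
  suffices ∀ k : ℕ, m.toSyn (k • α) < m.toSyn (Finsupp.single v 1) by simpa using this 1
  induction α using Finsupp.induction with
  | zero => intro k; simpa using toSyn_single_pos v
  | single_add u k α hu hk ih =>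
    have h1 : ∀ l : ℕ, m.toSyn (l • Finsupp.single u k) < m.toSyn (Finsupp.single v 1) := by
      intro l
      simpa using h u (by simp [hk]) (l * k)
    have h2 := ih fun w hw => h w (by simp [hw])
    intro l
    rcases le_total (m.toSyn (Finsupp.single u k)) (m.toSyn α) with hle | hle
    · refine lt_of_le_of_lt ?_ (h2 (l * 2))
      rw [mul_nsmul', two_nsmul, map_nsmul, map_nsmul, map_add, map_add]
      gcongr
    · refine lt_of_le_of_lt ?_ (h1 (l * 2))
      rw [mul_nsmul', two_nsmul, map_nsmul, map_nsmul, map_add, map_add]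
      gcongr

/-- Reduces the order estimate for a tail such as f_j or f_j ∂t_j to the fact that it lies in the
subalgebra generated by variables far below v. -/
theorem adjoin_le_wordSpan (v : VarE n p) :
    Subalgebra.toSubmodule (Algebra.adjoin K (genE K '' {u | MuchGreater m v u}))
      ≤ wordSpan m K (m.toSyn (Finsupp.single v 1)) := by
  rw [Algebra.adjoin_eq_span]
  refine Submodule.span_le.2 fun P hP => ?_
  suffices ∃ l : List (VarE n p), (∀ u ∈ l, MuchGreater m v u) ∧ P = wordE K l by
    obtain ⟨l, hl, rfl⟩ := this
    refine wordE_mem (toSyn_lt_of_muchGreater v _ fun u hu => hl u ?_)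
    clear hP hl
    induction l with
    | nil => simp at hu
    | cons a l ih =>
      by_cases e : u = a
      · simp [e]
      · refine List.mem_cons_of_mem _ (ih ?_)
        simpa [Finsupp.single_apply, Ne.symm e] using hu
  induction hP using Submonoid.closure_induction with
  | mem P h =>
    obtain ⟨u, hu, rfl⟩ := h
    exact ⟨[u], by simpa using hu, by simp [wordE]⟩
  | one => exact ⟨[], by simp, by simp [wordE]⟩
  | mul P Q _ _ hP hQ =>
    obtain ⟨l, hl, rfl⟩ := hP
    obtain ⟨r, hr, rfl⟩ := hQ
    refine ⟨l ++ r, ?_, (wordE_append l r).symm⟩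
    simpa [or_imp, forall_and] using ⟨hl, hr⟩

end Multiplicativity

/-! ### Evaluation of polynomials at elements of an algebra. -/

section PolyEval
variable {K : Type*} [Field K] {n : ℕ} {A B : Type*} [Ring A] [Algebra K A] [Ring B] [Algebra K B]

theorem map_polyEval (φ : A →ₐ[K] B) (u : Fin n → A) (h : MvPolynomial (Fin n) K) :
    φ (polyEval u h) = polyEval (fun i => φ (u i)) h := by
  simp [polyEval, map_list_prod, List.map_ofFn, Function.comp_def]

theorem polyEval_eq_aeval {A : Type*} [CommRing A] [Algebra K A] (u : Fin n → A)
    (h : MvPolynomial (Fin n) K) : polyEval u h = aeval u h := by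
  rw [polyEval, aeval_def, eval₂_eq']
  simp [List.prod_ofFn, Algebra.smul_def]

theorem polyEval_mem (S : Subalgebra K A) (u : Fin n → A) (hu : ∀ i, u i ∈ S)
    (h : MvPolynomial (Fin n) K) : polyEval u h ∈ S := by
  refine sum_mem fun α _ => S.smul_mem (list_prod_mem ?_) _
  simp only [List.mem_ofFn]
  rintro _ ⟨i, rfl⟩
  exact pow_mem (hu i) _

/-- Multiplication operators turn `polyEval` into evaluation. -/
theorem polyEval_mulLeft {A : Type*} [CommRing A] [Algebra K A] (u : Fin n → A)
    (h : MvPolynomial (Fin n) K) :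
    polyEval (fun i => LinearMap.mulLeft K (u i)) h = LinearMap.mulLeft K (aeval u h) := by
  rw [← polyEval_eq_aeval]
  exact (map_polyEval (Algebra.lmul K A) u h).symm

end PolyEval

end DModule

namespace DModule

open MvPolynomial

/-! ### Concrete models of the quotients of E' by the left ideals of S₁ and S₂. -/

section GroebnerReps
variable {K : Type*} [Field K] {n p : ℕ} (f : Fin p → MvPolynomial (Fin n) K)

/-- A polynomial in `x` as a polynomial in all the variables of `E'`. -/
noncomputable def polyX (h : MvPolynomial (Fin n) K) : MvPolynomial (VarE n p) K :=
  rename VarE.x h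

/-- The polynomial `∑_k (∂f_k/∂x_i) ∂t_k`. -/
noncomputable def connX (i : Fin n) : MvPolynomial (VarE n p) K :=
  ∑ k, polyX (pderiv i (f k)) * X (.dt k)

theorem pderiv_x_polyX (i : Fin n) (h : MvPolynomial (Fin n) K) :
    pderiv (.x i) (polyX h : MvPolynomial (VarE n p) K) = polyX (pderiv i h) :=
  pderiv_rename (fun a b h => by injection h) i h

theorem pderiv_dt_polyX (j : Fin p) (h : MvPolynomial (Fin n) K) :
    pderiv (.dt j) (polyX h : MvPolynomial (VarE n p) K) = 0 := by
  induction h using MvPolynomial.induction_on with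
  | C a => simp [polyX]
  | add a b ha hb => simp_all [polyX]
  | mul_X a i ha => simp_all [polyX, pderiv_X]

theorem shiftE_polyX (j : Fin p) (c : K) (h : MvPolynomial (Fin n) K) :
    shiftE K j c (polyX h : MvPolynomial (VarE n p) K) = polyX h := by
  induction h using MvPolynomial.induction_on with
  | C a => simp [polyX, shiftE]
  | add a b ha hb => simp_all [polyX]
  | mul_X a i ha => simp_all [polyX, shiftE]

theorem pderiv_dt_connX (j : Fin p) (i : Fin n) :
    pderiv (.dt j) (connX f i) = polyX (pderiv i (f j)) := by
  classical
  simp [connX, pderiv_dt_polyX, pderiv_X, Pi.single_apply]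

theorem pderiv_x_connX (i k : Fin n) :
    pderiv (.x i) (connX f k) = pderiv (.x k) (connX f i) := by
  simp [connX, pderiv_x_polyX, pderiv_X, pderiv_pderiv_comm i k]

theorem shiftE_connX (j : Fin p) (c : K) (i : Fin n) :
    shiftE K j c (connX f i) = connX f i := by
  simp [connX, shiftE_polyX]
  simp [shiftE]

/-- The action of the generators of `E'` on `E' / ⟨S₁⟩ ≅ K[x, s, ∂t]`; the remaining variables are
parameters. -/
noncomputable def actS₁ : VarE n p → Module.End K (MvPolynomial (VarE n p) K)
  | .x i => LinearMap.mulLeft K (X (.x i))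
  | .s j => LinearMap.mulLeft K (X (.s j))
  | .t j => (shiftE K j 1).toLinearMap ∘ₗ
      (LinearMap.mulLeft K (polyX (f j)) - (pderiv (.dt j)).toLinearMap)
  | .d i => (pderiv (.x i)).toLinearMap - LinearMap.mulLeft K (connX f i)
  | .dt j => LinearMap.mulLeft K (X (.dt j)) ∘ₗ (shiftE K j (-1)).toLinearMap

/-- The operators come from moving a generator to the right through F(x, s, ∂t) and then replacing
t_j by f_j and ∂_i by -∑_k (∂f_k/∂x_i) ∂t_k. Passing s_j produces the shifts, passing ∂t_j or x_i
the derivatives. The relation [∂_i, ∂_k] = 0 rests on the symmetry of the second derivatives of the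
f_k. -/
theorem actS₁_rel (a b : VarE n p) : actS₁ f a * actS₁ f b
    = actS₁ f b * actS₁ f a + FreeAlgebra.lift K (actS₁ f) (bracketE K n p a b) := by
  have hX : ∀ j (c : K) (v : VarE n p), shiftE K j c (X v) = if v = .s j then X v + C c else X v :=
    fun j c v => by simp [shiftE]
  have hp1 := fun i => pderiv_shiftE K (n := n) (p := p) (.x i) (by simp)
  have hp2 := fun i => pderiv_shiftE K (n := n) (p := p) (.dt i) (by simp)
  cases a <;> cases b <;> refine LinearMap.ext fun F => ?_ <;>
    simp only [actS₁, bracketE, Module.End.mul_apply, LinearMap.add_apply, LinearMap.comp_apply,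
      LinearMap.sub_apply, map_sub, shiftE_polyX, shiftE_connX, pderiv_x_polyX, pderiv_dt_polyX,
      pderiv_dt_connX,
      LinearMap.mulLeft_apply, AlgHom.toLinearMap_apply, Derivation.coeFn_coe, map_zero,
      LinearMap.zero_apply, map_mul, map_add, pderiv_mul, hX, hp1, hp2, pderiv_X, Pi.single_apply,
      reduceCtorEq, if_false]
  case d.d i k =>
    rw [pderiv_pderiv_comm, pderiv_x_connX f i k]
    ring1
  case t.dt k j =>
    rcases eq_or_ne j k with rfl | h
    · have hc := shiftE_cancel K (n := n) j 1
      simp only [if_true, hc, map_neg, map_one, LinearMap.neg_apply, Module.End.one_apply,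
        shiftE_comm K j j (-1) 1]
      ring1
    · simp only [shiftE_comm K k j, VarE.dt.injEq, h, if_false, map_zero,
        LinearMap.zero_apply]
      ring1
  case dt.t j k =>
    rcases eq_or_ne j k with rfl | h
    · have hc := shiftE_cancel K (n := n) j 1
      simp only [if_true, hc, map_one, Module.End.one_apply,
        shiftE_comm K j j (-1) 1]
      ring1
    · simp only [shiftE_comm K k j, VarE.dt.injEq, h, if_false, map_zero,
        LinearMap.zero_apply]
      ring1
  all_goals first
    | ring1
    | (rw [shiftE_comm]; ring1)
    | (rw [pderiv_pderiv_comm]; ring1)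
    | (split_ifs <;> subst_vars <;> simp_all [actS₁, shiftE_polyX] <;> ring1)
    | skip
  case t.t j k =>
    simp only [shiftE_comm K k j, pderiv_pderiv_comm (VarE.dt k) (VarE.dt j)]
    ring1

/-- The action of `E'` on `E' / ⟨S₁⟩`. -/
noncomputable def repS₁ : AlgE K n p →ₐ[K] Module.End K (MvPolynomial (VarE n p) K) :=
  LieTypeAlgebra.lift _ (actS₁ f) (actS₁_rel f)

/-- The action of the generators of `E'` on `E' / ⟨S₂⟩ ≅ K[x, ∂t]`; the remaining variables are
parameters. -/
noncomputable def actS₂ : VarE n p → Module.End K (MvPolynomial (VarE n p) K)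
  | .x i => LinearMap.mulLeft K (X (.x i))
  | .s j => LinearMap.mulLeft K (X (.dt j)) ∘ₗ
      ((pderiv (.dt j)).toLinearMap - LinearMap.mulLeft K (polyX (f j)))
  | .t j => LinearMap.mulLeft K (polyX (f j)) - (pderiv (.dt j)).toLinearMap
  | .d i => (pderiv (.x i)).toLinearMap - LinearMap.mulLeft K (connX f i)
  | .dt j => LinearMap.mulLeft K (X (.dt j))

/-- Now s_j is also replaced by -f_j ∂t_j once it has passed F(x, ∂t). The resulting operator is
-∂t_j t_j, so the relations for s_j reflect those of the Weyl algebra in t and ∂t. -/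
theorem actS₂_rel (a b : VarE n p) : actS₂ f a * actS₂ f b
    = actS₂ f b * actS₂ f a + FreeAlgebra.lift K (actS₂ f) (bracketE K n p a b) := by
  classical
  cases a <;> cases b <;> refine LinearMap.ext fun F => ?_ <;>
    simp only [actS₂, bracketE, Module.End.mul_apply, LinearMap.add_apply, LinearMap.comp_apply,
      LinearMap.sub_apply, map_sub, pderiv_x_polyX, pderiv_dt_polyX,
      pderiv_dt_connX,
      LinearMap.mulLeft_apply, Derivation.coeFn_coe, map_zero,
      LinearMap.zero_apply, map_add, pderiv_mul, pderiv_X, Pi.single_apply,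
      reduceCtorEq, if_false]
  case d.d i k =>
    rw [pderiv_pderiv_comm, pderiv_x_connX f i k]
    ring1
  case s.s i k =>
    rcases eq_or_ne i k with rfl | h
    · simp
    · simp [h, h.symm, pderiv_pderiv_comm (VarE.dt i) (VarE.dt k)]
      ring1
  all_goals first
    | ring1
    | (rw [pderiv_pderiv_comm]; ring1)
    | (simp only [VarE.dt.injEq, VarE.x.injEq]
       split_ifs <;> subst_vars <;>
        simp_all [actS₂] <;> ring1)
    | (simp only [VarE.dt.injEq]
       split_ifs <;> subst_vars <;>
        simp_all [actS₂] <;> rw [pderiv_pderiv_comm] <;> ring1)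

/-- The action of `E'` on `E' / ⟨S₂⟩`. -/
noncomputable def repS₂ : AlgE K n p →ₐ[K] Module.End K (MvPolynomial (VarE n p) K) :=
  LieTypeAlgebra.lift _ (actS₂ f) (actS₂_rel f)

end GroebnerReps

end DModule

namespace DModule

open MvPolynomial

/-! ### The Gröbner basis property of S₁ and S₂. -/

section GroebnerBases
variable {K : Type*} [Field K] {n p : ℕ}

theorem rep_basisE (ρ : AlgE K n p →ₐ[K] Module.End K (MvPolynomial (VarE n p) K))
    (T : Set (VarE n p))
    (h : ∀ v ∉ T, ∀ β : VarE n p →₀ ℕ, (∀ u ∈ T, β u = 0) →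
      (∀ u, β u ≠ 0 → rankE v ≤ rankE u) →
      ρ (genE K v) (monomial β 1) = monomial (Finsupp.single v 1 + β) 1)
    (α : VarE n p →₀ ℕ) (hα : ∀ u ∈ T, α u = 0) : ρ (basisE K α) 1 = monomial α 1 := by
  have h0 : ∀ l : List (VarE n p), ∀ u ∈ T, (l.map fun v => Finsupp.single v (α v)).sum u = 0 := by
    intro l u hu
    induction l with
    | nil => simp
    | cons v l ih =>
      by_cases e : v = u
      · subst e; simp [ih, hα v hu]
      · simp [ih, Finsupp.single_eq_of_ne (Ne.symm e)]
  have key : ∀ l : List (VarE n p), (l.Pairwise fun v u => rankE v ≤ rankE u) →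
      (l.map fun v => ρ (genE K v) ^ α v).prod 1 =
        monomial (l.map fun v => Finsupp.single v (α v)).sum 1 := by
    intro l hl
    induction l with
    | nil => simp
    | cons v l ih =>
      rw [List.pairwise_cons] at hl
      simp only [List.map_cons, List.prod_cons, List.sum_cons, Module.End.mul_apply, ih hl.2]
      by_cases hv : v ∈ T
      · simp [hα v hv]
      · generalize α v = k
        induction k with
        | zero => simp
        | succ k ihk =>
          rw [pow_succ', Module.End.mul_apply, ihk, h v hv, ← add_assoc, ← Finsupp.single_add,
            add_comm 1 k]
          · intro u hu
            have : v ≠ u := by rintro rfl; exact hv hu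
            simp [h0 l u hu, Finsupp.single_eq_of_ne this.symm]
          · intro u hu
            by_cases e : u = v
            · rw [e]
            · refine hl.1 u ((list_actE K α l hl.2).2 u ?_)
              simpa [Finsupp.single_apply, Ne.symm e] using hu
  have := key _ (enumE_pairwise (n := n) (p := p))
  rw [sum_enumE] at this
  rw [basisE_apply]
  simpa [LieTypeAlgebra.stdMonomial, map_list_prod, List.map_map, Function.comp_def] using this

/-- A standard monomial is applied from its right end, that is, by decreasing rank. So each
generator only needs to act as plain multiplication on monomials without variables of smaller rank,
and the images of 1 are then distinct monomials. -/
theorem linearIndependent_rep (ρ : AlgE K n p →ₐ[K] Module.End K (MvPolynomial (VarE n p) K))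
    (T : Set (VarE n p))
    (h : ∀ v ∉ T, ∀ β : VarE n p →₀ ℕ, (∀ u ∈ T, β u = 0) →
      (∀ u, β u ≠ 0 → rankE v ≤ rankE u) →
      ρ (genE K v) (monomial β 1) = monomial (Finsupp.single v 1 + β) 1) :
    LinearIndependent K fun α : {α : VarE n p →₀ ℕ // ∀ v ∈ T, α v = 0} =>
      ρ (basisE K α.1) 1 := by
  have := (basisMonomials (VarE n p) K).linearIndependent.comp
    (fun α : {α : VarE n p →₀ ℕ // ∀ v ∈ T, α v = 0} => α.1) Subtype.val_injective
  have e : (fun α : {α : VarE n p →₀ ℕ // ∀ v ∈ T, α v = 0} => ρ (basisE K α.1) 1) =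
      basisMonomials (VarE n p) K ∘ fun α => α.1 := by
    funext α
    simpa using rep_basisE ρ T h α.1 α.2
  rw [e]
  exact this

variable (f : Fin p → MvPolynomial (Fin n) K)

theorem repS₁_gen (v : VarE n p) : repS₁ f (genE K v) = actS₁ f v :=
  LieTypeAlgebra.lift_gen _ _ _ v

theorem repS₂_gen (v : VarE n p) : repS₂ f (genE K v) = actS₂ f v :=
  LieTypeAlgebra.lift_gen _ _ _ v

theorem aeval_x (h : MvPolynomial (Fin n) K) :
    aeval (fun i => (X (.x i) : MvPolynomial (VarE n p) K)) h = polyX h := by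
  have : aeval (fun i => (X (.x i) : MvPolynomial (VarE n p) K)) = rename (R := K) VarE.x := by
    ext1 i
    simp
  rw [this, polyX]

theorem repS₁_polyE (h : MvPolynomial (Fin n) K) :
    repS₁ f (polyE p h) = LinearMap.mulLeft K (polyX h) := by
  simp only [polyE, map_polyEval, repS₁_gen, actS₁, polyEval_mulLeft, aeval_x]

theorem repS₂_polyE (h : MvPolynomial (Fin n) K) :
    repS₂ f (polyE p h) = LinearMap.mulLeft K (polyX h) := by
  simp only [polyE, map_polyEval, repS₂_gen, actS₂, polyEval_mulLeft, aeval_x]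

/-- The elements of `S₂`, indexed by their leading monomials. -/
noncomputable def elemS : VarE n p → AlgE K n p
  | .t j => genE K (.t j) - polyE p (f j)
  | .d i => genE K (.d i) + ∑ k, polyE p (pderiv i (f k)) * genE K (.dt k)
  | .s j => genE K (.s j) + polyE p (f j) * genE K (.dt j)
  -- A dummy value for x_i and ∂t_j, which are not in either index set T.
  | v => genE K v

theorem setS₁_eq : setS₁ f = elemS f '' (Set.range VarE.t ∪ Set.range VarE.d) := by
  rw [Set.image_union, ← Set.range_comp, ← Set.range_comp]
  rfl

theorem setS₂_eq :
    setS₂ f = elemS f '' (Set.range VarE.t ∪ Set.range VarE.d ∪ Set.range VarE.s) := by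
  rw [setS₂, setS₁_eq, Set.image_union _ _ (Set.range VarE.s), ← Set.range_comp _ VarE.s]
  rfl

theorem genE_mem_adjoin {m : MonomialOrder (VarE n p)} {v u : VarE n p}
    (h : MuchGreater m v u) : genE K u ∈ Algebra.adjoin K (genE K '' {u | MuchGreater m v u}) :=
  Algebra.subset_adjoin ⟨u, h, rfl⟩

theorem elemS_sub_mem (m : MonomialOrder (VarE n p))
    (htx : ∀ (j : Fin p) (i : Fin n), MuchGreater m (.t j) (.x i))
    (hdx : ∀ i k : Fin n, MuchGreater m (.d i) (.x k))
    (hdt : ∀ (i : Fin n) (j : Fin p), MuchGreater m (.d i) (.dt j)) (v : VarE n p)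
    (hv : v ∈ Set.range VarE.t ∪ Set.range VarE.d) :
    elemS f v - genE K v ∈ wordSpan m K (m.toSyn (Finsupp.single v 1)) := by
  refine adjoin_le_wordSpan v ((Subalgebra.mem_toSubmodule _).2 ?_)
  rcases hv with ⟨j, rfl⟩ | ⟨i, rfl⟩
  · simp only [elemS, sub_sub_cancel_left, neg_mem_iff]
    exact polyEval_mem _ _ (fun i => genE_mem_adjoin (htx j i)) _
  · simp only [elemS, add_sub_cancel_left]
    exact sum_mem fun k _ => mul_mem
      (polyEval_mem _ _ (fun l => genE_mem_adjoin (hdx i l)) _)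
      (genE_mem_adjoin (hdt i k))

theorem elemS_s_sub_mem (m : MonomialOrder (VarE n p))
    (hsx : ∀ (j : Fin p) (i : Fin n), MuchGreater m (.s j) (.x i))
    (hst : ∀ j k : Fin p, MuchGreater m (.s j) (.dt k)) (j : Fin p) :
    elemS f (.s j) - genE K (.s j) ∈ wordSpan m K (m.toSyn (Finsupp.single (.s j) 1)) := by
  refine adjoin_le_wordSpan _ ((Subalgebra.mem_toSubmodule _).2 ?_)
  simp only [elemS, add_sub_cancel_left]
  exact mul_mem (polyEval_mem _ _ (fun i => genE_mem_adjoin (hsx j i)) _)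
    (genE_mem_adjoin (hst j j))

theorem X_mul_monomial_one {σ : Type*} (v : σ) (β : σ →₀ ℕ) :
    (X v * monomial β 1 : MvPolynomial σ K) = monomial (Finsupp.single v 1 + β) 1 := by
  rw [X, monomial_mul, one_mul]

theorem isLeftGroebnerBasis_setS₁ (m : MonomialOrder (VarE n p))
    (htx : ∀ (j : Fin p) (i : Fin n), MuchGreater m (.t j) (.x i))
    (hdx : ∀ i k : Fin n, MuchGreater m (.d i) (.x k))
    (hdt : ∀ (i : Fin n) (j : Fin p), MuchGreater m (.d i) (.dt j)) :
    IsLeftGroebnerBasis m (setS₁ f) := by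
  rw [setS₁_eq]
  refine isLeftGroebnerBasis_image (repS₁ f) 1 _
    ((Set.finite_range _).union (Set.finite_range _)) _ (elemS_sub_mem f m htx hdx hdt) ?_
    (linearIndependent_rep _ _ ?_)
  · rintro _ (⟨j, rfl⟩ | ⟨i, rfl⟩)
    · simp [elemS, repS₁_polyE, repS₁_gen, actS₁, shiftE_polyX]
    · simp [elemS, repS₁_polyE, repS₁_gen, actS₁, connX]
  · intro v hv β hβ hr
    -- When ∂t_j is applied, no s has occurred yet, so its shift of s_j does nothing.
    have hs : ∀ j, rankE v > 1 → β (.s j) = 0 := fun j h => by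
      by_contra h0
      exact absurd (hr _ h0) (not_le.2 h)
    rw [repS₁_gen]
    cases v with
    | x i => simp [actS₁, X_mul_monomial_one]
    | s j => simp [actS₁, X_mul_monomial_one]
    | t j => simp at hv
    | d i => simp at hv
    | dt j =>
      simp [actS₁, shiftE_monomial K j (-1) β (hs j (by simp [rankE])), X_mul_monomial_one]

theorem isLeftGroebnerBasis_setS₂ (m : MonomialOrder (VarE n p))
    (htx : ∀ (j : Fin p) (i : Fin n), MuchGreater m (.t j) (.x i))
    (hdx : ∀ i k : Fin n, MuchGreater m (.d i) (.x k))
    (hdt : ∀ (i : Fin n) (j : Fin p), MuchGreater m (.d i) (.dt j))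
    (hsx : ∀ (j : Fin p) (i : Fin n), MuchGreater m (.s j) (.x i))
    (hst : ∀ j k : Fin p, MuchGreater m (.s j) (.dt k)) :
    IsLeftGroebnerBasis m (setS₂ f) := by
  rw [setS₂_eq]
  refine isLeftGroebnerBasis_image (repS₂ f) 1 _
    (((Set.finite_range _).union (Set.finite_range _)).union (Set.finite_range _)) _ ?_ ?_
    (linearIndependent_rep _ _ ?_)
  · rintro v (hv | ⟨j, rfl⟩)
    · exact elemS_sub_mem f m htx hdx hdt v hv
    · exact elemS_s_sub_mem f m hsx hst j
  · rintro _ ((⟨j, rfl⟩ | ⟨i, rfl⟩) | ⟨j, rfl⟩)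
    · simp [elemS, repS₂_polyE, repS₂_gen, actS₂]
    · simp [elemS, repS₂_polyE, repS₂_gen, actS₂, connX]
    · simp [elemS, repS₂_polyE, repS₂_gen, actS₂]
      ring
  · intro v hv β hβ hr
    rw [repS₂_gen]
    cases v with
    | x i => simp [actS₂, X_mul_monomial_one]
    | s j => simp at hv
    | t j => simp at hv
    | d i => simp at hv
    | dt j => simp [actS₂, X_mul_monomial_one]

end GroebnerBases

end DModule

/-! ### Polynomials in commuting operators, and sets of polynomials closed under differentiation. -/

namespace DModule

open MvPolynomial

/-- Commuting elements generate a commutative subalgebra, where ordinary evaluation is available. -/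
theorem exists_evalHom {K A σ : Type*} [Field K] [Ring A] [Algebra K A] (u : σ → A)
    (h : ∀ a b, u a * u b = u b * u a) :
    ∃ φ : MvPolynomial σ K →ₐ[K] A, ∀ v, φ (X v) = u v := by
  have hc := Algebra.isMulCommutative_adjoin K (s := Set.range u)
    (by rintro _ ⟨a, rfl⟩ _ ⟨b, rfl⟩; exact h a b)
  let _ : CommRing (Algebra.adjoin K (Set.range u)) :=
    { (Algebra.adjoin K (Set.range u)).toRing with mul_comm := hc.is_comm.comm }
  exact ⟨(Algebra.adjoin K (Set.range u)).val.comp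
    (aeval fun v => ⟨u v, Algebra.subset_adjoin ⟨v, rfl⟩⟩), fun v => by simp⟩

/-- If the commutator with `P` is a derivation `D` on the generators, it is so everywhere. -/
theorem mul_evalHom_eq {K A σ : Type*} [Field K] [Ring A] [Algebra K A]
    (φ : MvPolynomial σ K →ₐ[K] A) (D : Derivation K (MvPolynomial σ K) (MvPolynomial σ K))
    (P : A) (h : ∀ v, P * φ (X v) = φ (X v) * P + φ (D (X v))) (F : MvPolynomial σ K) :
    P * φ F = φ F * P + φ (D F) := by
  induction F using MvPolynomial.induction_on with
  | C a =>
    rw [← algebraMap_eq, Derivation.map_algebraMap, AlgHom.commutes]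
    simp [Algebra.commutes]
  | add a b ha hb => simp only [map_add, mul_add, add_mul, ha, hb]; abel
  | mul_X a v ha =>
    rw [map_mul, ← mul_assoc, ha, add_mul, mul_assoc, h, Derivation.leibniz]
    simp only [smul_eq_mul, map_add, map_mul, mul_add, ← mul_assoc]
    rw [← map_mul φ (X v), mul_comm (X v), map_mul]
    abel

/-- The coefficient of ∂F/∂v at α - e_v is α(v) times that of F at α, and α(v) ≠ 0 is invertible in
characteristic zero. -/
theorem eq_C_of_pderiv_eq_zero {K σ : Type*} [Field K] [CharZero K] {F : MvPolynomial σ K}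
    (h : ∀ v, pderiv v F = 0) : F = C (coeff 0 F) := by
  classical
  ext α
  rw [coeff_C]
  split_ifs with e
  · rw [e]
  · obtain ⟨v, hv⟩ : ∃ v, α v ≠ 0 := by
      by_contra h0
      push Not at h0
      exact e (Finsupp.ext fun v => (h0 v).symm)
    have h1 := congrArg (coeff (α - Finsupp.single v 1)) (h v)
    have h2 : α - Finsupp.single v 1 + Finsupp.single v 1 = α :=
      tsub_add_cancel_of_le (by simpa using Nat.one_le_iff_ne_zero.2 hv)
    rw [coeff_pderiv, h2, coeff_zero, mul_eq_zero] at h1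
    refine h1.resolve_right ?_
    exact Nat.cast_add_one_ne_zero _

theorem totalDegree_pderiv_lt {K σ : Type*} [Field K] {F : MvPolynomial σ K} {v : σ}
    (h : pderiv v F ≠ 0) : (pderiv v F).totalDegree < F.totalDegree := by
  obtain ⟨α, hα, e⟩ := Finset.exists_mem_eq_sup (pderiv v F).support (by simpa using h)
    fun s => s.degree
  have h1 : coeff (α + Finsupp.single v 1) F ≠ 0 := by
    rw [mem_support_iff, coeff_pderiv] at hα
    exact left_ne_zero_of_mul hα
  have h2 := le_totalDegree (mem_support_iff.2 h1)
  have h3 : (pderiv v F).totalDegree = α.degree := e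
  rw [h3]
  change (α + Finsupp.single v 1).degree ≤ _ at h2
  rw [map_add, Finsupp.degree_single] at h2
  omega

/-- A subspace of polynomials that is stable under all partial derivatives and contains no nonzero
constant is trivial. -/
theorem eq_zero_of_pderiv_stable {K σ : Type*} [Field K] [CharZero K]
    (N : MvPolynomial σ K → Prop) (hD : ∀ v F, N F → N (pderiv v F))
    (hC : ∀ c : K, N (C c) → c = 0) (F : MvPolynomial σ K) (hF : N F) : F = 0 := by
  induction hk : F.totalDegree using Nat.strong_induction_on generalizing F with
  | _ k ih =>
    subst hk
    have h0 : ∀ v, pderiv v F = 0 := fun v => by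
      -- A nonzero derivative would have smaller degree and still satisfy N, so it vanishes by
      -- induction.
      by_contra h
      exact h (ih _ (totalDegree_pderiv_lt h) _ (hD v F hF) rfl)
    have h1 := eq_C_of_pderiv_eq_zero h0
    rw [h1] at hF ⊢
    rw [hC _ hF, C_0]

/-! ### Reduction of D_n ⊗ S_p modulo the left ideal I to K[x, ∂t]. -/

section ShiftAlgebra
variable {K : Type*} [Field K] {n p : ℕ} (f : Fin p → MvPolynomial (Fin n) K)

/-- The generators of the commutative subalgebra `K[x, ∂t]` of `D_n ⊗ S_p`. -/
def varXT : Fin n ⊕ Fin p → VarB n p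
  | .inl i => .x i
  | .inr j => .dt j

theorem exists_evalXT : ∃ φ : MvPolynomial (Fin n ⊕ Fin p) K →ₐ[K] AlgB K n p,
    ∀ v, φ (X v) = genB K (varXT v) := by
  refine exists_evalHom _ fun a b => ?_
  rw [LieTypeAlgebra.gen_mul_gen]
  cases a <;> cases b <;> simp [varXT, bracketB]

/-- The embedding of `K[x, ∂t]` into `D_n ⊗ S_p`. -/
noncomputable def evalXT : MvPolynomial (Fin n ⊕ Fin p) K →ₐ[K] AlgB K n p :=
  exists_evalXT.choose

theorem evalXT_X (v : Fin n ⊕ Fin p) : evalXT (K := K) (X v) = genB K (varXT v) :=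
  exists_evalXT.choose_spec v

theorem evalXT_rename (h : MvPolynomial (Fin n) K) :
    evalXT (rename Sum.inl h) = polyEval (fun i => genB K (.x i : VarB n p)) h := by
  have : (rename Sum.inl h : MvPolynomial (Fin n ⊕ Fin p) K) =
      polyEval (fun i => X (Sum.inl i)) h := by
    rw [polyEval_eq_aeval]
    have : (rename (R := K) Sum.inl : _ →ₐ[K] MvPolynomial (Fin n ⊕ Fin p) K) =
        aeval fun i => X (Sum.inl i) := by
      ext1 i
      simp
    rw [this]
  rw [this, map_polyEval]
  simp [evalXT_X, varXT]

/-- The generator `s_j + f_j ∂t_j`. -/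
noncomputable def elemBs (j : Fin p) : AlgB K n p :=
  genB K (.s j) + polyEval (fun i => genB K (.x i)) (f j) * genB K (.dt j)

/-- The generator `∂_i + ∑_k (∂f_k/∂x_i) ∂t_k`. -/
noncomputable def elemBd (i : Fin n) : AlgB K n p :=
  genB K (.d i) + ∑ k, polyEval (fun l => genB K (.x l)) (pderiv i (f k)) * genB K (.dt k)

theorem bmIdeal_eq : bmIdeal f = Ideal.span (Set.range (elemBs f) ∪ Set.range (elemBd f)) := rfl

theorem elemBs_eq (j : Fin p) :
    elemBs f j = genB K (.s j) + evalXT (rename Sum.inl (f j) * X (Sum.inr j)) := by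
  simp [elemBs, evalXT_rename, evalXT_X, varXT]

theorem elemBd_eq (i : Fin n) : elemBd f i = genB K (.d i) +
    evalXT (∑ k, rename Sum.inl (pderiv i (f k)) * X (Sum.inr k)) := by
  simp [elemBd, evalXT_rename, evalXT_X, varXT]

/-- K[x, ∂t] is commutative, so adding one of its elements to a does not change the commutators with
it. -/
theorem mul_evalXT_of_add (a : AlgB K n p) (G : MvPolynomial (Fin n ⊕ Fin p) K)
    (D : Derivation K (MvPolynomial (Fin n ⊕ Fin p) K) (MvPolynomial (Fin n ⊕ Fin p) K))
    (h : ∀ v, a * evalXT (X v) = evalXT (X v) * a + evalXT (D (X v)))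
    (F : MvPolynomial (Fin n ⊕ Fin p) K) :
    (a + evalXT G) * evalXT F = evalXT F * (a + evalXT G) + evalXT (D F) := by
  rw [add_mul, mul_evalHom_eq evalXT D a h, mul_add, ← map_mul, ← map_mul, mul_comm G]
  abel

/-- Serves twice: to eliminate ∂_i modulo I, and to show that the polynomials killing f^s are closed
under ∂/∂x_i. -/
theorem elemBd_mul (i : Fin n) (F : MvPolynomial (Fin n ⊕ Fin p) K) :
    elemBd f i * evalXT F = evalXT F * elemBd f i + evalXT (pderiv (Sum.inl i) F) := by
  classical
  rw [elemBd_eq]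
  refine mul_evalXT_of_add _ _ _ (fun v => ?_) F
  rw [evalXT_X, LieTypeAlgebra.gen_mul_gen]
  cases v with
  | inl k =>
    simp only [varXT, bracketB, pderiv_X, Pi.single_apply, Sum.inl.injEq, eq_comm (a := k)]
    split_ifs <;> simp
  | inr k => simp [varXT, bracketB, pderiv_X]

theorem elemBs_mul (j : Fin p) (F : MvPolynomial (Fin n ⊕ Fin p) K) :
    elemBs f j * evalXT F =
      evalXT F * elemBs f j + evalXT (X (Sum.inr j) * pderiv (Sum.inr j) F) := by
  classical
  rw [elemBs_eq]
  refine mul_evalXT_of_add _ _ ((X (Sum.inr j) : MvPolynomial (Fin n ⊕ Fin p) K) •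
    pderiv (R := K) (Sum.inr j)) (fun v => ?_) F
  rw [evalXT_X, LieTypeAlgebra.gen_mul_gen]
  cases v with
  | inl k => simp [varXT, bracketB, pderiv_X]
  | inr k =>
    simp only [varXT, bracketB, pderiv_X, Pi.single_apply, Sum.inr.injEq, eq_comm (a := k),
      Derivation.smul_apply]
    split_ifs with h
    · subst h
      simpa [varXT, LieTypeAlgebra.gen] using (evalXT_X (K := K) (Sum.inr j : Fin n ⊕ Fin p)).symm
    · simp

/-- `D_n ⊗ S_p` is the sum of the ideal and of `K[x, ∂t]`. -/
theorem exists_sub_evalXT_mem (P : AlgB K n p) (F : MvPolynomial (Fin n ⊕ Fin p) K) :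
    ∃ F', P * evalXT F - evalXT F' ∈ bmIdeal f := by
  have hs : ∀ j, elemBs f j ∈ bmIdeal f := fun j => Ideal.subset_span (Or.inl ⟨j, rfl⟩)
  have hd : ∀ i, elemBd f i ∈ bmIdeal f := fun i => Ideal.subset_span (Or.inr ⟨i, rfl⟩)
  -- The factor F is kept arbitrary because, in a product PQ, the remainder of Q F is the polynomial
  -- to which P is applied next.
  induction P using LieTypeAlgebra.induction_on generalizing F with
  | algebraMap r => exact ⟨r • F, by simp [Algebra.smul_def]⟩
  | gen v =>
    cases v with
    | x i => exact ⟨X (Sum.inl i) * F, by simp [evalXT_X, varXT]⟩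
    | dt i => exact ⟨X (Sum.inr i) * F, by simp [evalXT_X, varXT]⟩
    | s j =>
      refine ⟨X (Sum.inr j) * pderiv (Sum.inr j) F - rename Sum.inl (f j) * X (Sum.inr j) * F, ?_⟩
      have := (bmIdeal f).mul_mem_left (evalXT F) (hs j)
      rw [eq_sub_of_add_eq (elemBs_mul f j F).symm, elemBs_eq, add_mul, ← map_mul] at this
      convert this using 1
      rw [map_sub]
      abel
    | d i =>
      refine ⟨pderiv (Sum.inl i) F -
        (∑ k, rename Sum.inl (pderiv i (f k)) * X (Sum.inr k)) * F, ?_⟩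
      have := (bmIdeal f).mul_mem_left (evalXT F) (hd i)
      rw [eq_sub_of_add_eq (elemBd_mul f i F).symm, elemBd_eq, add_mul, ← map_mul] at this
      convert this using 1
      rw [map_sub]
      abel
  | mul P Q hP hQ =>
    obtain ⟨F₁, h₁⟩ := hQ F
    obtain ⟨F₂, h₂⟩ := hP F₁
    refine ⟨F₂, ?_⟩
    have := add_mem ((bmIdeal f).mul_mem_left P h₁) h₂
    rwa [mul_sub, sub_add_sub_cancel, ← mul_assoc] at this
  | add P Q hP hQ =>
    obtain ⟨F₁, h₁⟩ := hP F
    obtain ⟨F₂, h₂⟩ := hQ F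
    refine ⟨F₁ + F₂, ?_⟩
    have := add_mem h₁ h₂
    rwa [sub_add_sub_comm, ← add_mul, ← map_add] at this

end ShiftAlgebra

end DModule

namespace DModule

open MvPolynomial

/-! ### The action of D_n ⊗ S_p on the module of f^s, and its annihilator. -/

section ShiftLoc
variable {K : Type*} [Field K] {n p : ℕ}

/-- The substitution `s_j ↦ s_j + c` on `K[x, s]`. -/
noncomputable def shiftXS (j : Fin p) (c : K) : PolyXS K n p →ₐ[K] PolyXS K n p :=
  aeval fun v => if v = Sum.inr j then X v + C c else X v

theorem shiftXS_rename (j : Fin p) (c : K) (h : MvPolynomial (Fin n) K) :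
    shiftXS j c (rename Sum.inl h : PolyXS K n p) = rename Sum.inl h := by
  have : (shiftXS j c).comp (rename Sum.inl) =
      (rename Sum.inl : MvPolynomial (Fin n) K →ₐ[K] PolyXS K n p) := by
    ext1 i
    simp [shiftXS]
  exact DFunLike.congr_fun this h

theorem shiftXS_comm (j k : Fin p) (b c : K) (F : PolyXS K n p) :
    shiftXS j b (shiftXS k c F) = shiftXS k c (shiftXS j b F) := by
  have : (shiftXS (n := n) j b).comp (shiftXS k c) = (shiftXS k c).comp (shiftXS j b) := by
    ext1 v
    simp only [shiftXS, AlgHom.comp_apply, aeval_X]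
    split_ifs <;> simp_all [add_right_comm]
  exact DFunLike.congr_fun this F

theorem shiftXS_cancel (j : Fin p) (c : K) (F : PolyXS K n p) :
    shiftXS j c (shiftXS j (-c) F) = F := by
  have : (shiftXS (n := n) j c).comp (shiftXS j (-c)) = AlgHom.id K _ := by
    ext1 v
    simp only [shiftXS, AlgHom.comp_apply, aeval_X]
    split_ifs <;> simp_all
  exact DFunLike.congr_fun this F

theorem pderiv_shiftXS (i : Fin n) (j : Fin p) (c : K) (F : PolyXS K n p) :
    pderiv (Sum.inl i) (shiftXS j c F) = shiftXS j c (pderiv (Sum.inl i) F) := by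
  induction F using MvPolynomial.induction_on with
  | C a => simp [shiftXS]
  | add a b ha hb => simp [ha, hb]
  | mul_X a w ha =>
    have : pderiv (Sum.inl i) (shiftXS j c (X w)) =
        shiftXS j c (pderiv (Sum.inl i) (X w : PolyXS K n p)) := by
      simp only [shiftXS, aeval_X]
      split_ifs <;> by_cases h : w = Sum.inl i <;> simp_all [pderiv_X]
    simp only [map_mul, pderiv_mul, map_add, ha, this]

variable (f : Fin p → MvPolynomial (Fin n) K)

theorem shiftXS_prodXS (j : Fin p) (c : K) : shiftXS j c (prodXS f) = prodXS f := by
  simp [prodXS, shiftXS_rename]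

/-- The substitution `s_j ↦ s_j + c` on `K[x, s, 1/(f_1 ⋯ f_p)]`. -/
noncomputable def shiftFs (j : Fin p) (c : K) : ModFs f →ₐ[K] ModFs f :=
  IsLocalization.liftAlgHom (M := Submonoid.powers (prodXS f))
    (f := (IsScalarTower.toAlgHom K (PolyXS K n p) (ModFs f)).comp (shiftXS j c)) (by
      rintro ⟨_, k, rfl⟩
      simpa [shiftXS_prodXS] using
        (IsLocalization.Away.algebraMap_isUnit (S := ModFs f) (prodXS f)).pow k)

theorem shiftFs_algebraMap (j : Fin p) (c : K) (F : PolyXS K n p) :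
    shiftFs f j c (algebraMap _ _ F) = algebraMap _ (ModFs f) (shiftXS j c F) := by
  simp [shiftFs]

theorem algHom_ext_modFs {A : Type*} [CommRing A] [Algebra K A] {φ ψ : ModFs f →ₐ[K] A}
    (h : ∀ F : PolyXS K n p, φ (algebraMap _ _ F) = ψ (algebraMap _ _ F)) (b : ModFs f) :
    φ b = ψ b := by
  have : (φ : ModFs f →+* A) = ψ := by
    apply IsLocalization.ringHom_ext (Submonoid.powers (prodXS f))
    exact RingHom.ext h
  exact DFunLike.congr_fun this b

theorem shiftFs_comm (j k : Fin p) (b c : K) (u : ModFs f) :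
    shiftFs f j b (shiftFs f k c u) = shiftFs f k c (shiftFs f j b u) :=
  algHom_ext_modFs f (φ := (shiftFs f j b).comp (shiftFs f k c))
    (ψ := (shiftFs f k c).comp (shiftFs f j b))
    (fun F => by simp [shiftFs_algebraMap, shiftXS_comm j k]) u

theorem shiftFs_cancel (j : Fin p) (c : K) (u : ModFs f) :
    shiftFs f j c (shiftFs f j (-c) u) = u :=
  algHom_ext_modFs f (φ := (shiftFs f j c).comp (shiftFs f j (-c))) (ψ := AlgHom.id K _)
    (fun F => by simp [shiftFs_algebraMap, shiftXS_cancel]) u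

/-- The derivation `∂/∂x_i` on `K[x, s, 1/(f_1 ⋯ f_p)]`. -/
noncomputable abbrev derivFs (i : Fin n) : Derivation K (ModFs f) (ModFs f) :=
  locDeriv (Submonoid.powers (prodXS f)) (ModFs f) (pderiv (Sum.inl i))

/-- Writing u as a fraction a/y, both operators are applied in either order to u y = a. They commute
on polynomials, so the unit obtained by shifting y can be cancelled. -/
theorem derivFs_shiftFs (i : Fin n) (j : Fin p) (c : K) (u : ModFs f) :
    derivFs f i (shiftFs f j c u) = shiftFs f j c (derivFs f i u) := by
  obtain ⟨a, y, rfl⟩ := IsLocalization.exists_mk'_eq (Submonoid.powers (prodXS f)) u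
  set u := IsLocalization.mk' (ModFs f) a y with hu
  have hy : u * algebraMap (PolyXS K n p) (ModFs f) y = algebraMap _ _ a :=
    IsLocalization.mk'_spec _ a y
  have hy' : shiftFs f j c u * algebraMap (PolyXS K n p) (ModFs f) (shiftXS j c y) =
      algebraMap _ _ (shiftXS j c a) := by
    rw [← shiftFs_algebraMap, ← map_mul, hy, shiftFs_algebraMap]
  have hunit : IsUnit (algebraMap (PolyXS K n p) (ModFs f) (shiftXS j c y)) := by
    rw [← shiftFs_algebraMap]
    exact (IsLocalization.map_units (ModFs f) y).map _
  have h1 := congrArg (fun b => shiftFs f j c (derivFs f i b)) hy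
  have h2 := congrArg (fun b => derivFs f i b) hy'
  simp only [Derivation.leibniz, locDeriv_algebraMap, smul_eq_mul, map_add, map_mul,
    shiftFs_algebraMap, pderiv_shiftXS] at h1 h2
  rw [← h1] at h2
  exact hunit.mul_left_cancel (add_left_cancel h2)

/-- The image of `f_j` in `K[x, s, 1/(f_1 ⋯ f_p)]`. -/
noncomputable def fFs (j : Fin p) : ModFs f :=
  algebraMap (PolyXS K n p) (ModFs f) (rename Sum.inl (f j))

/-- The inverse of `f_j` in `K[x, s, 1/(f_1 ⋯ f_p)]`. -/
noncomputable def invFs (j : Fin p) : ModFs f := Ring.inverse (fFs f j)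

/-- The image of `s_j`. -/
noncomputable def sFs (j : Fin p) : ModFs f :=
  algebraMap (PolyXS K n p) (ModFs f) (X (Sum.inr j))

/-- The image of a polynomial in `x`. -/
noncomputable def polyFs (h : MvPolynomial (Fin n) K) : ModFs f :=
  algebraMap (PolyXS K n p) (ModFs f) (rename Sum.inl h)

theorem fFs_mul_invFs (j : Fin p) : fFs f j * invFs f j = 1 :=
  Ring.mul_inverse_cancel _ (isUnit_algebraMap_modFs f j)

theorem shiftFs_polyFs (j : Fin p) (c : K) (h : MvPolynomial (Fin n) K) :
    shiftFs f j c (polyFs f h) = polyFs f h := by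
  rw [polyFs, shiftFs_algebraMap, shiftXS_rename]

theorem shiftFs_fFs (j k : Fin p) (c : K) : shiftFs f j c (fFs f k) = fFs f k :=
  shiftFs_polyFs f j c (f k)

theorem shiftFs_invFs (j k : Fin p) (c : K) : shiftFs f j c (invFs f k) = invFs f k := by
  have h := congrArg (shiftFs f j c) (fFs_mul_invFs f k)
  rw [map_mul, shiftFs_fFs, map_one, ← fFs_mul_invFs f k] at h
  exact (isUnit_algebraMap_modFs f k).mul_left_cancel h

theorem shiftFs_sFs_self (j : Fin p) (c : K) :
    shiftFs f j c (sFs f j) = sFs f j + algebraMap K (ModFs f) c := by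
  rw [sFs, shiftFs_algebraMap, IsScalarTower.algebraMap_apply K (PolyXS K n p) (ModFs f)]
  simp [shiftXS, algebraMap_eq]

theorem shiftFs_sFs_of_ne {j k : Fin p} (h : k ≠ j) (c : K) :
    shiftFs f j c (sFs f k) = sFs f k := by
  rw [sFs, shiftFs_algebraMap]
  simp [shiftXS, h]

theorem derivFs_polyFs (i : Fin n) (h : MvPolynomial (Fin n) K) :
    derivFs f i (polyFs f h) = polyFs f (pderiv i h) := by
  rw [polyFs, locDeriv_algebraMap, pderiv_rename Sum.inl_injective, polyFs]

theorem derivFs_invFs (i : Fin n) (j : Fin p) :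
    derivFs f i (invFs f j) = -invFs f j ^ 2 * polyFs f (pderiv i (f j)) := by
  rw [Derivation.leibniz_of_mul_eq_one _
    (show invFs f j * fFs f j = 1 by rw [mul_comm, fFs_mul_invFs]), smul_eq_mul]
  exact congrArg _ (derivFs_polyFs f i (f j))

theorem derivFs_sFs (i : Fin n) (j : Fin p) : derivFs f i (sFs f j) = 0 := by
  rw [sFs, locDeriv_algebraMap, pderiv_X_of_ne (by simp), map_zero]

theorem logDerivFs_eq (i : Fin n) : logDerivFs (ModFs f) f i =
    ∑ k, sFs f k * polyFs f (pderiv i (f k)) * invFs f k := by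
  simp [logDerivFs, sFs, polyFs, invFs, fFs]

theorem shiftFs_logDerivFs (i : Fin n) (j : Fin p) (c : K) :
    shiftFs f j c (logDerivFs (ModFs f) f i) = logDerivFs (ModFs f) f i +
      algebraMap K (ModFs f) c * polyFs f (pderiv i (f j)) * invFs f j := by
  have : ∀ k, shiftFs f j c (sFs f k * polyFs f (pderiv i (f k)) * invFs f k) =
      sFs f k * polyFs f (pderiv i (f k)) * invFs f k +
        if k = j then algebraMap K (ModFs f) c * polyFs f (pderiv i (f j)) * invFs f j else 0 := by
    intro k
    rw [map_mul, map_mul, shiftFs_invFs, shiftFs_polyFs]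
    split_ifs with h
    · subst h
      rw [shiftFs_sFs_self]
      ring
    · rw [shiftFs_sFs_of_ne f h, add_zero]
  rw [logDerivFs_eq, map_sum, Finset.sum_congr rfl fun k _ => this k, Finset.sum_add_distrib]
  simp

/-- The operator `∂t_j (b f^s) = -s_j f_j⁻¹ b(s_j - 1) f^s`. -/
noncomputable def dtFs (j : Fin p) : Module.End K (ModFs f) :=
  -(LinearMap.mulLeft K (sFs f j * invFs f j) ∘ₗ (shiftFs f j (-1)).toLinearMap)

theorem dtFs_apply (j : Fin p) (b : ModFs f) :
    dtFs f j b = -(sFs f j * invFs f j * shiftFs f j (-1) b) := rfl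

/-- The operator `t_j (b f^s) = f_j b(s_j + 1) f^s`. -/
noncomputable def tFs (j : Fin p) : Module.End K (ModFs f) :=
  LinearMap.mulLeft K (fFs f j) ∘ₗ (shiftFs f j 1).toLinearMap

theorem tFs_apply (j : Fin p) (b : ModFs f) : tFs f j b = fFs f j * shiftFs f j 1 b := rfl

/-- The action of the generators of `D_n ⊗ S_p` on `K[x, s, 1/(f_1 ⋯ f_p)] f^s`. -/
noncomputable def actBFs : VarB n p → Module.End K (ModFs f)
  | .x i => actFs (Submonoid.powers (prodXS f)) (ModFs f) f (.x i)
  | .s j => actFs (Submonoid.powers (prodXS f)) (ModFs f) f (.s j)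
  | .d i => actFs (Submonoid.powers (prodXS f)) (ModFs f) f (.d i)
  | .dt j => dtFs f j

theorem actFs_x_apply (i : Fin n) (b : ModFs f) :
    actFs (Submonoid.powers (prodXS f)) (ModFs f) f (.x i) b = polyFs f (X i) * b := by
  simp [actFs, polyFs]

theorem actFs_s_apply (j : Fin p) (b : ModFs f) :
    actFs (Submonoid.powers (prodXS f)) (ModFs f) f (.s j) b = sFs f j * b := rfl

theorem actFs_d_apply (i : Fin n) (b : ModFs f) :
    actFs (Submonoid.powers (prodXS f)) (ModFs f) f (.d i) b =
      derivFs f i b + logDerivFs (ModFs f) f i * b := rfl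

theorem dtFs_mul_x (j : Fin p) (i : Fin n) :
    dtFs f j * actBFs f (.x i) = actBFs f (.x i) * dtFs f j := by
  refine LinearMap.ext fun b => ?_
  simp only [actBFs, Module.End.mul_apply, actFs_x_apply, dtFs_apply, map_mul, shiftFs_polyFs]
  ring

theorem dtFs_mul_s_self (j : Fin p) :
    dtFs f j * actBFs f (.s j) = actBFs f (.s j) * dtFs f j - dtFs f j := by
  refine LinearMap.ext fun b => ?_
  simp only [actBFs, Module.End.mul_apply, actFs_s_apply, dtFs_apply, map_mul, shiftFs_sFs_self,
    LinearMap.sub_apply, map_neg, map_one]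
  ring

theorem dtFs_mul_s_of_ne {j k : Fin p} (h : k ≠ j) :
    dtFs f j * actBFs f (.s k) = actBFs f (.s k) * dtFs f j := by
  refine LinearMap.ext fun b => ?_
  simp only [actBFs, Module.End.mul_apply, actFs_s_apply, dtFs_apply, map_mul,
    shiftFs_sFs_of_ne f h]
  ring

theorem dtFs_mul_dtFs (j k : Fin p) : dtFs f j * dtFs f k = dtFs f k * dtFs f j := by
  rcases eq_or_ne j k with rfl | h
  · rfl
  refine LinearMap.ext fun b => ?_
  simp only [Module.End.mul_apply, dtFs_apply, map_mul, map_neg, shiftFs_invFs,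
    shiftFs_sFs_of_ne f h, shiftFs_sFs_of_ne f h.symm, shiftFs_comm f j k]
  ring

/-- Replacing s_j by s_j - 1 changes the logarithmic derivative of f^s by -(∂f_j/∂x_i)/f_j. This is
exactly offset by differentiating the factor f_j⁻¹ in ∂t_j. -/
theorem dtFs_mul_d (j : Fin p) (i : Fin n) :
    dtFs f j * actBFs f (.d i) = actBFs f (.d i) * dtFs f j := by
  refine LinearMap.ext fun b => ?_
  simp only [actBFs, Module.End.mul_apply, actFs_d_apply, dtFs_apply, map_mul, map_neg, map_add,
    shiftFs_logDerivFs, Derivation.leibniz, smul_eq_mul, derivFs_shiftFs, derivFs_invFs,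
    derivFs_sFs, map_one]
  ring

theorem actBFs_rel (a b : VarB n p) : actBFs f a * actBFs f b =
    actBFs f b * actBFs f a + FreeAlgebra.lift K (actBFs f) (bracketB K n p a b) := by
  have hA := actFs_rel (Submonoid.powers (prodXS f)) (ModFs f) f (isUnit_algebraMap_modFs f)
  have hs : ∀ j k : Fin p, dtFs f j * actBFs f (.s k) = actBFs f (.s k) * dtFs f j +
      FreeAlgebra.lift K (actBFs f) (if k = j then -FreeAlgebra.ι K (.dt j) else 0) := by
    intro j k
    split_ifs with h
    · subst h
      rw [dtFs_mul_s_self, sub_eq_add_neg]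
      simp [actBFs]
    · simp [dtFs_mul_s_of_ne f h]
  cases a with
  | dt j =>
    cases b with
    | dt k => simpa [bracketB, actBFs] using dtFs_mul_dtFs f j k
    | x i => simpa [bracketB, actBFs] using dtFs_mul_x f j i
    | d i => simpa [bracketB, actBFs] using dtFs_mul_d f j i
    | s k => exact hs j k
  | x i =>
    cases b with
    | dt j => simpa [bracketB, actBFs] using (dtFs_mul_x f j i).symm
    | x k => simpa [bracketB, bracketA, actBFs] using hA (.x i) (.x k)
    | d k =>
      have := hA (.x i) (.d k)
      simp only [bracketB, bracketA, actBFs] at this ⊢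
      rw [this]
      split_ifs <;> simp
    | s k => simpa [bracketB, bracketA, actBFs] using hA (.x i) (.s k)
  | d i =>
    cases b with
    | dt j => simpa [bracketB, actBFs] using (dtFs_mul_d f j i).symm
    | x k =>
      have := hA (.d i) (.x k)
      simp only [bracketB, bracketA, actBFs] at this ⊢
      rw [this]
      split_ifs <;> simp
    | d k => simpa [bracketB, bracketA, actBFs] using hA (.d i) (.d k)
    | s k => simpa [bracketB, bracketA, actBFs] using hA (.d i) (.s k)
  | s k =>
    cases b with
    | dt j =>
      have := hs j k
      change actBFs f (.s k) * dtFs f j = dtFs f j * actBFs f (.s k) + _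
      rw [this]
      simp only [bracketB]
      split_ifs <;> simp
    | x i => simpa [bracketB, bracketA, actBFs] using hA (.s k) (.x i)
    | d i => simpa [bracketB, bracketA, actBFs] using hA (.s k) (.d i)
    | s j => simpa [bracketB, bracketA, actBFs] using hA (.s k) (.s j)

/-- The action of `D_n ⊗ S_p` on `K[x, s, 1/(f_1 ⋯ f_p)] f^s`. -/
noncomputable def repBFs : AlgB K n p →ₐ[K] Module.End K (ModFs f) :=
  LieTypeAlgebra.lift _ (actBFs f) (actBFs_rel f)

theorem repBFs_gen (v : VarB n p) : repBFs f (genB K v) = actBFs f v :=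
  LieTypeAlgebra.lift_gen _ _ _ v

theorem repBFs_inclAB (P : AlgA K n p) : repBFs f (inclAB K n p P) = repFs f P := by
  induction P using LieTypeAlgebra.induction_on with
  | algebraMap r => simp only [AlgHom.commutes]
  | gen v =>
    rw [inclAB, LieTypeAlgebra.lift_gen, repFs, LieTypeAlgebra.lift_gen, repBFs_gen]
    cases v <;> rfl
  | mul P Q hP hQ => simp only [map_mul, hP, hQ]
  | add P Q hP hQ => simp only [map_add, hP, hQ]

theorem repBFs_polyEval (h : MvPolynomial (Fin n) K) (b : ModFs f) :
    repBFs f (polyEval (fun i => genB K (.x i)) h) b = polyFs f h * b := by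
  have e : ∀ i, repBFs f (genB K (.x i)) = LinearMap.mulLeft K (polyFs f (X i)) := fun i => by
    refine LinearMap.ext fun b => ?_
    rw [repBFs_gen]
    exact actFs_x_apply f i b
  have e2 : aeval (fun i => polyFs f (X i)) h = polyFs f h := by
    have : aeval (fun i => polyFs f (X i)) =
        (IsScalarTower.toAlgHom K (PolyXS K n p) (ModFs f)).comp (rename (R := K) Sum.inl) := by
      ext1 i
      simp [polyFs]
    rw [this]
    rfl
  rw [map_polyEval, funext e, polyEval_mulLeft, e2, LinearMap.mulLeft_apply]

theorem repBFs_elemBs (j : Fin p) : repBFs f (elemBs f j) 1 = 0 := by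
  rw [elemBs, map_add, map_mul, LinearMap.add_apply, Module.End.mul_apply, repBFs_polyEval,
    repBFs_gen, repBFs_gen]
  simp only [actBFs, actFs_s_apply, dtFs_apply, map_one, mul_one]
  have : polyFs f (f j) * invFs f j = 1 := fFs_mul_invFs f j
  linear_combination (-sFs f j) * this

theorem repBFs_elemBd (i : Fin n) : repBFs f (elemBd f i) 1 = 0 := by
  simp only [elemBd, map_add, map_sum, map_mul, LinearMap.add_apply, LinearMap.sum_apply,
    Module.End.mul_apply, repBFs_polyEval, repBFs_gen]
  simp only [actBFs, actFs_d_apply, dtFs_apply, map_one, mul_one, Derivation.map_one_eq_zero,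
    logDerivFs_eq, zero_add, ← Finset.sum_add_distrib]
  exact Finset.sum_eq_zero fun k _ => by ring

theorem repBFs_eq_zero_of_mem {P : AlgB K n p} (hP : P ∈ bmIdeal f) : repBFs f P 1 = 0 := by
  refine apply_eq_zero_of_mem_span (repBFs f) 1 ?_ (bmIdeal_eq f ▸ hP)
  rintro _ (⟨j, rfl⟩ | ⟨i, rfl⟩)
  · exact repBFs_elemBs f j
  · exact repBFs_elemBd f i

/-- The algebra D_n ⊗ S_p has no t_j, but its module carries such an operator, whose commutator with
K[x, ∂t] provides differentiation with respect to ∂t_j. -/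
theorem tFs_mul (j : Fin p) (F : MvPolynomial (Fin n ⊕ Fin p) K) :
    tFs f j * repBFs f (evalXT F) =
      repBFs f (evalXT F) * tFs f j + repBFs f (evalXT (-pderiv (Sum.inr j) F)) := by
  classical
  refine mul_evalHom_eq ((repBFs f).comp evalXT) (-pderiv (R := K) (Sum.inr j)) (tFs f j) ?_ F
  intro v
  rw [AlgHom.comp_apply, AlgHom.comp_apply, evalXT_X, repBFs_gen]
  refine LinearMap.ext fun b => ?_
  cases v with
  | inl i =>
    simp [varXT, actBFs, tFs_apply, actFs_x_apply, shiftFs_polyFs]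
    ring
  | inr k =>
    have hinv := fFs_mul_invFs f k
    rcases eq_or_ne k j with rfl | h
    · have h1 := shiftFs_cancel f k 1 b
      have h2 := shiftFs_comm f k k 1 (-1) b
      rw [h1] at h2
      simp [varXT, actBFs, tFs_apply, dtFs_apply, shiftFs_invFs, shiftFs_sFs_self, h1, ← h2,
        shiftFs_fFs]
      linear_combination (-b) * hinv
    · simp [varXT, actBFs, tFs_apply, dtFs_apply, shiftFs_invFs, shiftFs_sFs_of_ne f h,
        shiftFs_fFs, pderiv_X_of_ne (show (Sum.inr k : Fin n ⊕ Fin p) ≠ Sum.inr j by simpa using h),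
        shiftFs_comm f j k 1 (-1)]
      ring

theorem tFs_one (j : Fin p) : tFs f j 1 = repBFs f (polyEval (fun i => genB K (.x i)) (f j)) 1 := by
  rw [tFs_apply, map_one, repBFs_polyEval]
  rfl

/-- This is where f_j ≠ 0 enters: if some f_j vanished, the localization would be zero and every
operator would kill f^s. -/
theorem nontrivial_modFs (hf : ∀ j, f j ≠ 0) : Nontrivial (ModFs f) := by
  refine OreLocalization.nontrivial_of_nonZeroDivisors
    (powers_le_nonZeroDivisors_of_noZeroDivisors ?_)
  exact Finset.prod_ne_zero_iff.2 fun j _ =>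
    (map_ne_zero_iff _ (rename_injective _ Sum.inl_injective)).2 (hf j)

theorem eq_zero_of_repBFs_evalXT [CharZero K] (hf : ∀ j, f j ≠ 0)
    (F : MvPolynomial (Fin n ⊕ Fin p) K) (hF : repBFs f (evalXT F) 1 = 0) : F = 0 := by
  refine eq_zero_of_pderiv_stable (fun F => repBFs f (evalXT F) 1 = 0) ?_ ?_ F hF
  · rintro (i | j) F hF
    · have h := congrArg (fun P => repBFs f P 1) (elemBd_mul f i F)
      simpa [hF, repBFs_elemBd] using h.symm
    · have h := congrArg (fun P => P 1) (tFs_mul f j F)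
      -- Since t_j f^s = f_j f^s and f_j commutes with F, one gets F t_j f^s = f_j F f^s = 0.
      have h2 : repBFs f (evalXT F) (tFs f j 1) = 0 := by
        rw [tFs_one, ← evalXT_rename, ← Module.End.mul_apply, ← map_mul, ← map_mul, mul_comm,
          map_mul, map_mul, Module.End.mul_apply, hF, map_zero]
      simpa [hF, h2] using h.symm
  · intro c hc
    have := nontrivial_modFs f hf
    rw [← algebraMap_eq, AlgHom.commutes, AlgHom.commutes] at hc
    simpa [Module.algebraMap_end_apply] using hc

theorem annFs_eq_comap [CharZero K] (hf : ∀ j, f j ≠ 0) :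
    annFs f = (bmIdeal f).comap (inclAB K n p) := by
  ext P
  rw [Ideal.mem_comap]
  change repFs f P 1 = 0 ↔ _
  rw [← repBFs_inclAB]
  refine ⟨fun h => ?_, repBFs_eq_zero_of_mem f⟩
  -- The remainder F of P modulo I kills f^s together with P, hence is zero, and P lies in I.
  obtain ⟨F, hF⟩ := exists_sub_evalXT_mem f (inclAB K n p P) 1
  rw [map_one, mul_one] at hF
  have h1 := repBFs_eq_zero_of_mem f hF
  rw [map_sub, LinearMap.sub_apply, h, zero_sub, neg_eq_zero] at h1
  rwa [eq_zero_of_repBFs_evalXT f hf F h1, map_zero, sub_zero] at hF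

end ShiftLoc

end DModule

theorem lemma3p1 {K : Type*} [Field K] [CharZero K] {n p : ℕ}
    (f : Fin p → MvPolynomial (Fin n) K) :
    (∀ m : MonomialOrder (DModule.VarE n p),
      (∀ (j : Fin p) (i : Fin n), DModule.MuchGreater m (.t j) (.x i)) →
      (∀ i k : Fin n, DModule.MuchGreater m (.d i) (.x k)) →
      (∀ (i : Fin n) (j : Fin p), DModule.MuchGreater m (.d i) (.dt j)) →
      (∀ (j : Fin p) (i : Fin n), DModule.MuchGreater m (.s j) (.x i)) →
      (∀ j k : Fin p, DModule.MuchGreater m (.s j) (.dt k)) →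
      DModule.IsLeftGroebnerBasis m (DModule.setS₁ f) ∧
      DModule.IsLeftGroebnerBasis m (DModule.setS₂ f)) ∧
    ((∀ j, f j ≠ 0) →
      DModule.annFs f = (DModule.bmIdeal f).comap (DModule.inclAB K n p)) :=
  ⟨fun m htx hdx hdt hsx hst => ⟨DModule.isLeftGroebnerBasis_setS₁ f m htx hdx hdt,
    DModule.isLeftGroebnerBasis_setS₂ f m htx hdx hdt hsx hst⟩, DModule.annFs_eq_comap f⟩
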